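/- Let $D$ be an oriented virtual link diagram and $k$ a commutative ring. Let $V=k[X]/(X^2)$ with basis $1,X$, multiplication $m$, comultiplication $\Delta(1)=1\otimes X+X\otimes 1$, $\Delta(X)=X\otimes X$, and bar operation $\overline{1}=1$, $\overline{X}=-X$. A state $s$ of $D$ is a choice of the $A$- or $B$-smoothing at each classical crossing; smoothing gives a collection of cycles, and $C(s)=\bigotimes_{\text{cycles of } s}V$, i.e. the free $k$-module on the labellings of the cycles of $s$ by $1$ and $X$. *Local data.* Draw each classical crossing with both strands pointing upwards. Give it the canonical source-sink orientation: both ends of one fixed strand (say the one from lower left to upper right) point into the crossing and both ends of the other strand point out. Both smoothings of the crossing inherit orientations on their arcs. Put a cut locus on every semi-arc (part of the diagram between consecutive classical crossings) along which the source-sink orientations of its two ends disagree. Label the two arcs of the vertical smoothing $1,2$ (say left, right) and those of the horizontal smoothing $1,2$ (say top, bottom). These conventions are the same at all crossings. *Global data.* For every state choose arbitrarily a marked point (not a cut locus) on each cycle and a total order of the cycles. *Partial differentials.* Let $s$ have an $A$-smoothing at the crossing $\tau$ and let $t$ be the state obtained from $s$ by changing it to the $B$-smoothing. The uncorrected map $C(s)\to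 C(t)$ is $m$ on the two cycles through $\tau$ if they merge, $\Delta$ if one cycle splits (the arcs labelled $1,2$ at $\tau$ giving the two cycles), and the single-cycle map $\eta=0$ if one cycle is turned into one cycle; it is the identity on the labels of the cycles that miss $\tau$. The partial differential $\partial_\tau\colon C(s)\to C(t)$ is this map corrected as follows. 1. (Bars.) It is pre-composed with the bar operation, applied in the factor of each cycle of $s$ through $\tau$ as many times as there are cut loci on a path along the cycle between the smoothing at $\tau$ and the marked point. It is post-composed in the same way for the cycles of $t$ through $\tau$; a cycle that misses $\tau$ belongs to both $s$ and $t$, and in its factor the bar operation is applied as many times as there are cut loci on a path from its marked point in $s$ to its marked point in $t$. 2. (Signs.) The local order of the cycles of $s$ at $\tau$ consists of the cycle through the arc labelled $1$, then the cycle through the arc labelled $2$ if it is a different one, then the remaining cycles in their global order in $s$. The local order of the cycles of $t$ at $\tau$ is formed in the same way, with the remaining cycles (the same curves as in $s$) in the same relative order as in $s$. The map is multiplied by the signs of the permutations that take the local order to the global order, for $s$ and for $t$. Then every face of the cube anti-commutes: for every state $s$ and all crossings $\tau_1\neq\tau_2$ at which $s$ has $A$-smoothings, $$\partial_{\tau_2}\circ\partial_{\tau_1}=-\,\partial_{\tau_1}\circ\partial_{\tau_2}\colon\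 C(s)\to C(s_{12}),$$ where $s_{12}$ is $s$ with both smoothings changed to $B$. Consequently $\partial=\sum_\tau\partial_\tau$ on $\bigoplus_s C(s)$ satisfies $\partial^2=0$. This holds for every commutative ring $k$, for every choice of the global data, and for either choice of the strand pointing in and of the arc labelled $1$ in the vertical and in the horizontal smoothing. -/

import Mathlib

/-!
Khovanov cube of a virtual link diagram with `η = 0`, bar corrections from cut loci and sign
corrections from orderings of the cycles.

An oriented virtual link diagram is recorded by its signed oriented Gauss data.  Draw every
classical crossing with both strands pointing upwards; its four ends are then the corners
`sw`, `se` (incoming) and `nw`, `ne` (outgoing), and the two strands are `sw → ne` and `se → nw`.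
The semi-arcs join outgoing to incoming ends.  Virtual crossings carry no data.
-/

namespace VirtualKhovanov

inductive Corner where
  | sw | se | ne | nw
  deriving DecidableEq

instance : Fintype Corner where
  elems := {.sw, .se, .ne, .nw}
  complete := by intro x; cases x <;> decide

def Corner.Incoming : Corner → Prop
  | .sw => True
  | .se => True
  | .ne => False
  | .nw => False

/-- An oriented virtual link diagram.  `glue` sends an end of a semi-arc to its other end.  A
crossing is positive iff its over-strand is `sw → ne`.  `freeLoops` is the number of link
components without classical crossings. -/
structure Diagram where
  n : ℕ
  positive : Fin n → Prop
  glue : Fin n × Corner → Fin n × Corner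
  glue_glue : ∀ h, glue (glue h) = h
  glue_incoming : ∀ h, (glue h).2.Incoming ↔ ¬ h.2.Incoming
  freeLoops : ℕ

/-- The ends of the semi-arcs at the crossings. -/
abbrev Diagram.HalfEdge (D : Diagram) : Type := Fin D.n × Corner

inductive Smoothing where
  | A | B
  deriving DecidableEq

instance : Fintype Smoothing where
  elems := {.A, .B}
  complete := by intro x; cases x <;> decide

abbrev Diagram.State (D : Diagram) : Type := Fin D.n → Smoothing

/-- The pictures that fix the canonical source-sink orientation and the canonical local order at
an upward oriented crossing.  `risingIn`: both ends of the strand `sw → ne` point into the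
crossing and both ends of `se → nw` point out of it (otherwise the reverse).  `leftFirst`,
`topFirst`: which arc of the vertical, respectively horizontal, smoothing carries the label `1`. -/
structure Convention where
  risingIn : Bool
  leftFirst : Bool
  topFirst : Bool

/-- In the source-sink orientation, the end at this corner points into the crossing. -/
def Convention.PointsIn (κ : Convention) : Corner → Prop
  | .sw => κ.risingIn = true
  | .ne => κ.risingIn = true
  | .se => κ.risingIn = false
  | .nw => κ.risingIn = false

namespace Diagram

variable (D : Diagram)

/-- The state `s` smooths the crossing `c` by the two vertical arcs `sw - nw` and `se - ne`, as
opposed to the two horizontal arcs `sw - se` and `nw - ne`.  At a positive crossing the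
`A`-smoothing is vertical, at a negative crossing the `B`-smoothing is. -/
def Vertical (s : D.State) (c : Fin D.n) : Prop := s c = .A ↔ D.positive c

open Classical in
/-- The other end of the smoothing arc that ends at `h`. -/
noncomputable def smooth (s : D.State) (h : D.HalfEdge) : D.HalfEdge :=
  (h.1,
    if D.Vertical s h.1 then
      match h.2 with
      | .sw => .nw
      | .nw => .sw
      | .se => .ne
      | .ne => .se
    else
      match h.2 with
      | .sw => .se
      | .se => .sw
      | .nw => .ne
      | .ne => .nw)

/-- There is a cut locus on the semi-arc through `h`: the source-sink orientations at its two ends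
point both into, or both out of, the adjacent crossings, so they disagree along the semi-arc. -/
def Cut (κ : Convention) (h : D.HalfEdge) : Prop :=
  κ.PointsIn h.2 ↔ κ.PointsIn (D.glue h).2

open Classical in
/-- `CutPath κ s h h' m`: in the state `s` a path along a cycle leads from `h` to `h'` and crosses
`m` cut loci. -/
inductive CutPath (κ : Convention) (s : D.State) : D.HalfEdge → D.HalfEdge → ℕ → Prop
  | refl (h : D.HalfEdge) : CutPath κ s h h 0
  | smooth {h h' : D.HalfEdge} {m : ℕ} :
      CutPath κ s h h' m → CutPath κ s h (D.smooth s h') m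
  | glue {h h' : D.HalfEdge} {m : ℕ} :
      CutPath κ s h h' m → CutPath κ s h (D.glue h') (m + if D.Cut κ h' then 1 else 0)

/-- The number of cut loci crossed on a path from `h` to `h'`.  Every cycle carries an even number
of cut loci, so the parity does not depend on the path; the least number is taken. -/
noncomputable def cutCount (κ : Convention) (s : D.State) (h h' : D.HalfEdge) : ℕ :=
  sInf {m | D.CutPath κ s h h' m}

def Step (s : D.State) (h h' : D.HalfEdge) : Prop := h' = D.smooth s h ∨ h' = D.glue h

/-- The cycles of a state that pass through crossings. -/
abbrev Loop (s : D.State) : Type := Quot (D.Step s)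

/-- All cycles of a state. -/
abbrev Cycle (s : D.State) : Type := D.Loop s ⊕ Fin D.freeLoops

noncomputable instance instFintypeCycle (s : D.State) : Fintype (D.Cycle s) := Fintype.ofFinite _

/-- The cycle of the state `s` through `h`. -/
def cycleAt (s : D.State) (h : D.HalfEdge) : D.Cycle s := Sum.inl (Quot.mk _ h)

open Classical in
/-- An end of the arc labelled `1` in the smoothing of the crossing `τ`. -/
noncomputable def arc₁ (κ : Convention) (s : D.State) (τ : Fin D.n) : D.HalfEdge :=
  (τ, if D.Vertical s τ then (if κ.leftFirst then .sw else .se)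
      else (if κ.topFirst then .nw else .sw))

open Classical in
/-- An end of the arc labelled `2` in the smoothing of the crossing `τ`. -/
noncomputable def arc₂ (κ : Convention) (s : D.State) (τ : Fin D.n) : D.HalfEdge :=
  (τ, if D.Vertical s τ then (if κ.leftFirst then .se else .sw)
      else (if κ.topFirst then .sw else .nw))

/-- The cycle through the arc labelled `1` at `τ`. -/
noncomputable def cycle₁ (κ : Convention) (s : D.State) (τ : Fin D.n) : D.Cycle s :=
  D.cycleAt s (D.arc₁ κ s τ)

/-- The cycle through the arc labelled `2` at `τ`. -/
noncomputable def cycle₂ (κ : Convention) (s : D.State) (τ : Fin D.n) : D.Cycle s :=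
  D.cycleAt s (D.arc₂ κ s τ)

/-- The arbitrary global choices: for every state, a marked point on each of its cycles (the
global orientation of the cycle is the source-sink orientation at the marked point; a free loop has
no cut loci and needs none) and an ordering of its cycles. -/
structure GlobalChoice where
  star : ∀ s : D.State, D.Loop s → D.HalfEdge
  star_mem : ∀ (s : D.State) (q : D.Loop s), (Quot.mk _ (star s q) : D.Loop s) = q
  order : ∀ s : D.State, D.Cycle s ≃ Fin (Fintype.card (D.Cycle s))

end Diagram

/-- The basis `1, X` of the algebra `V = k[X]/(X²)`. -/
inductive Label where
  | one | X
  deriving DecidableEq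

instance : Fintype Label where
  elems := {.one, .X}
  complete := by intro x; cases x <;> decide

/-- The coefficient of `c` in the product `m (a ⊗ b)`. -/
def mulCoeff (k : Type*) [CommRing k] : Label → Label → Label → k
  | .one, .one, .one => 1
  | .one, .X, .X => 1
  | .X, .one, .X => 1
  | _, _, _ => 0

/-- The coefficient of `b ⊗ c` in the coproduct `Δ a`. -/
def comulCoeff (k : Type*) [CommRing k] : Label → Label → Label → k
  | .one, .one, .X => 1
  | .one, .X, .one => 1
  | .X, .X, .X => 1
  | _, _, _ => 0

/-- The bar operation multiplies the basis vector `1` by `1` and `X` by `-1`. -/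
def barCoeff (k : Type*) [CommRing k] : Label → k
  | .one => 1
  | .X => -1

/-- The sign of the permutation that takes the local order of a finite set, which lists its
elements by increasing `key`, to the global order `e`. -/
def orderSign {α : Type*} {n : ℕ} (e : α ≃ Fin n) (key : α → ℕ) : ℤˣ :=
  Equiv.Perm.sign (Tuple.sort (key ∘ e.symm))

namespace Diagram

variable (k : Type*) [CommRing k] (D : Diagram)

/-- A labelling of the cycles of `s` by `1` and `X`: a basis vector of the tensor product of the
copies of `V` indexed by the cycles. -/
abbrev EnhancedState (s : D.State) : Type := D.Cycle s → Label

noncomputable instance instFintypeEnhancedState (s : D.State) : Fintype (D.EnhancedState s) :=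
  Fintype.ofFinite _

/-- The chain module of a state: the span of its enhanced states. -/
abbrev Chain (s : D.State) : Type _ := D.EnhancedState s →₀ k

variable {D}

/-- Apply the bar operation `f c` times in the tensor factor of each cycle `c`. -/
noncomputable def barMap {s : D.State} (f : D.Cycle s → ℕ) : D.Chain k s →ₗ[k] D.Chain k s :=
  Finsupp.linearCombination k fun l : D.EnhancedState s =>
    Finsupp.single l (∏ c, barCoeff k (l c) ^ f c)

/-- The labellings `l` and `l'` agree on all cycles that do not pass through `τ`. -/
def AgreeOff (κ : Convention) {s t : D.State} (τ : Fin D.n)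
    (l : D.EnhancedState s) (l' : D.EnhancedState t) : Prop :=
  (∀ h : D.HalfEdge, D.cycleAt s h ≠ D.cycle₁ κ s τ → D.cycleAt s h ≠ D.cycle₂ κ s τ →
    l' (D.cycleAt t h) = l (D.cycleAt s h)) ∧
  ∀ i : Fin D.freeLoops, l' (Sum.inr i) = l (Sum.inr i)

open Classical in
/-- The coefficient of `l'` in the uncorrected map for the change of smoothing at `τ` from `s` to
`t`: multiplication if two cycles merge, comultiplication if one cycle splits, and `η = 0` if one
cycle is turned into one cycle. -/
noncomputable def siteCoeff (κ : Convention) {s t : D.State} (τ : Fin D.n)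
    (l : D.EnhancedState s) (l' : D.EnhancedState t) : k :=
  if AgreeOff κ τ l l' then
    if D.cycle₁ κ s τ ≠ D.cycle₂ κ s τ then
      mulCoeff k (l (D.cycle₁ κ s τ)) (l (D.cycle₂ κ s τ)) (l' (D.cycle₁ κ t τ))
    else if D.cycle₁ κ t τ ≠ D.cycle₂ κ t τ then
      comulCoeff k (l (D.cycle₁ κ s τ)) (l' (D.cycle₁ κ t τ)) (l' (D.cycle₂ κ t τ))
    else 0
  else 0

/-- The uncorrected map: `m`, `Δ` or `η` at `τ`. -/
noncomputable def siteMap (κ : Convention) (s t : D.State) (τ : Fin D.n) :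
    D.Chain k s →ₗ[k] D.Chain k t :=
  Finsupp.linearCombination k fun l : D.EnhancedState s =>
    ∑ l' : D.EnhancedState t, Finsupp.single l' (siteCoeff k κ τ l l')

namespace GlobalChoice

variable (g : D.GlobalChoice) (κ : Convention)

/-- The cycle of `s` through the marked point of a cycle of `t`.  If `t` differs from `s` only at
`τ` and the cycle of `t` misses `τ`, this is the same closed curve. -/
def carry (s t : D.State) : D.Cycle t → D.Cycle s
  | Sum.inl q => D.cycleAt s (g.star t q)
  | Sum.inr i => Sum.inr i

/-- The number of cut loci crossed from `h` to the marked point of its cycle. -/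
noncomputable def barsTo (s : D.State) (h : D.HalfEdge) : ℕ :=
  D.cutCount κ s h (g.star s (Quot.mk _ h))

open Classical in
/-- Number of bars in the pre-composition: a cycle through `τ` is transported between its marked
point and the smoothing at `τ`. -/
noncomputable def preBars (s : D.State) (τ : Fin D.n) (c : D.Cycle s) : ℕ :=
  if c = D.cycle₁ κ s τ then g.barsTo κ s (D.arc₁ κ s τ)
  else if c = D.cycle₂ κ s τ then g.barsTo κ s (D.arc₂ κ s τ)
  else 0

open Classical in
/-- Number of bars in the post-composition: a cycle through `τ` is transported from the smoothing
at `τ` to its marked point in `t`; any other cycle is common to `s` and `t` and is transported from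
its marked point in `s` to its marked point in `t`. -/
noncomputable def postBars (s t : D.State) (τ : Fin D.n) (c : D.Cycle t) : ℕ :=
  if c = D.cycle₁ κ t τ then g.barsTo κ t (D.arc₁ κ t τ)
  else if c = D.cycle₂ κ t τ then g.barsTo κ t (D.arc₂ κ t τ)
  else match c with
    | Sum.inl q => g.barsTo κ t (g.star s (Quot.mk _ (g.star t q)))
    | Sum.inr _ => 0

open Classical in
/-- The local order of the cycles of `s` at `τ`: first the cycle labelled `1`, then (if different)
the cycle labelled `2`, then the remaining cycles in their global order. -/
noncomputable def preKey (s : D.State) (τ : Fin D.n) (c : D.Cycle s) : ℕ :=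
  if c = D.cycle₁ κ s τ then 0
  else if c = D.cycle₂ κ s τ then 1
  else 2 + (g.order s c : ℕ)

open Classical in
/-- The local order of the cycles of `t` at `τ` along the edge from `s` to `t`: first the cycle
labelled `1`, then (if different) the cycle labelled `2`, then the remaining cycles, which are
common to `s` and `t`, in the same relative order as in the local order of `s`. -/
noncomputable def postKey (s t : D.State) (τ : Fin D.n) (c : D.Cycle t) : ℕ :=
  if c = D.cycle₁ κ t τ then 0
  else if c = D.cycle₂ κ t τ then 1
  else 2 + (g.order s (g.carry s t c) : ℕ)

/-- The partial differential of the edge `s → t` at `τ`: the map `m`, `Δ` or `η`, pre- and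
post-composed with the bar operations and with the signs of the local-to-global permutations. -/
noncomputable def partialDiff (s t : D.State) (τ : Fin D.n) : D.Chain k s →ₗ[k] D.Chain k t :=
  ((orderSign (g.order t) (g.postKey κ s t τ) * orderSign (g.order s) (g.preKey κ s τ) : ℤˣ) : ℤ) •
    (barMap k (g.postBars κ s t τ) ∘ₗ siteMap k κ s t τ ∘ₗ barMap k (g.preBars κ s τ))

/-- The differential on the sum of the chain modules of all states. -/
noncomputable def differential :
    (∀ s : D.State, D.Chain k s) →ₗ[k] (∀ s : D.State, D.Chain k s) :=
  LinearMap.pi fun t => ∑ τ ∈ Finset.univ.filter (fun τ => t τ = Smoothing.B),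
    g.partialDiff k κ (Function.update t τ .A) t τ ∘ₗ LinearMap.proj (Function.update t τ .A)

end GlobalChoice

end Diagram

end VirtualKhovanov

/-! Attach to a point `p` of the diagram the operator `opX`: multiplication by X in the factor of
the cycle through `p`, with the sign of the cut loci met on the way from `p` to the marked point.
Both m and Δ commute with multiplication by X, and the bar corrections are exactly what makes the
signs fit, so every partial differential commutes with all these operators (`partialDiff_opX`). The
labelling of all cycles by 1 generates the chain module under them (`ext_unit`), so a face has to be
checked at this one vector only. There a merge gives ± the unit, a split gives ± `sumX` applied to
the unit (the corrected Δ(1)), and a single-cycle edge gives 0. What remains is a comparison of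
signs.

A global order of the cycles of P is a volume form on the functions on these cycles. If Q arises by
merging two cycles at τ, the functions on the cycles of Q are those on the cycles of P that are
killed by the covector `diffAt τ`. Up to a local sign that depends on the labelled arcs, the edge
sign compares the volume of P with `diffAt τ` wedged with the volume of Q (`EdgeRel`, from
`det_eq_of_identify`); a split is read backwards. Two independent merges wedge the same two
covectors in opposite orders, whence the sign -1 (`EdgeRel.diamond`).

In a bigon both crossings meet the same two cycles. The two covectors then agree up to signs u and v
before and after (`EdgeRel.bigon`), while the operators `sumX` at the two crossings differ by a
product x of directions. Adding up directions along the intersection of a cycle before with a cycle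
after gives u v x = -1 (`match_mul_match`), which is the required sign.

At a single-cycle edge the cycle runs through τ twice in opposite directions, so `sumX` vanishes.
Hence a split followed by a merge is zero whenever the opposite path consists of two single-cycle
edges. A merge followed by a split never faces two such edges. Counting cycles shows that, in any
other face with a single-cycle edge, both paths contain one. -/

namespace VirtualKhovanov

/-! ### Orders of finite sets as determinants -/

section Determinant

open Matrix

/-- The determinant of the values of functions on a finite set, taken before and after two points
of the set are identified, changes by the signs of the orders that list these points first. -/
theorem det_eq_of_identify {C C' : Type*} {n : ℕ} (e : C ≃ Fin (n + 1)) (e' : C' ≃ Fin n)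
    (q : C → C') (c₁ c₂ : C) (hne : c₁ ≠ c₂) (hq : q c₁ = q c₂)
    (key : C → ℕ) (key' : C' → ℕ) (hkey : Function.Injective key)
    (h₁ : ∀ x, x ≠ c₁ → key c₁ < key x) (h₂ : ∀ x, x ≠ c₁ → x ≠ c₂ → key c₂ < key x)
    (h₁' : ∀ x, x ≠ c₁ → x ≠ c₂ → key' (q c₁) < key' (q x))
    (hmono : ∀ x y, x ≠ c₁ → x ≠ c₂ → y ≠ c₁ → y ≠ c₂ → key x < key y → key' (q x) < key' (q y))
    (v₀ : C → ℤ) (v : Fin n → C' → ℤ) :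
    (of fun i j => (Fin.cons v₀ fun j => v j ∘ q : Fin (n + 1) → C → ℤ) j (e.symm i)).det =
      ((orderSign e key * orderSign e' key' : ℤˣ) : ℤ) * (v₀ c₁ - v₀ c₂) *
        (of fun i j => v j (e'.symm i)).det := by
  classical
  -- Two different points need at least two rows; the proof uses rows 0 and 1.
  obtain ⟨m, rfl⟩ : ∃ m, n = m + 1 := by
    rcases n with _ | m
    · exact absurd (e.injective (Subsingleton.elim (α := Fin 1) _ _)) hne
    · exact ⟨m, rfl⟩
  set σ := Tuple.sort (key ∘ e.symm) with hσ
  set σ' := Tuple.sort (key' ∘ e'.symm) with hσ'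
  let f : Fin (m + 2) → C := fun i => e.symm (σ i)
  have hfb : Function.Bijective f := e.symm.bijective.comp σ.bijective
  have hf : StrictMono (key ∘ f) :=
    (Tuple.monotone_sort (key ∘ e.symm)).strictMono_of_injective (hkey.comp hfb.1)
  have hf0 : f 0 = c₁ := by
    by_contra h
    obtain ⟨i, hi⟩ := hfb.2 c₁
    have h0 : (0 : Fin (m + 2)) < i := by
      rw [Fin.pos_iff_ne_zero]; rintro rfl; exact h hi
    have := hf h0
    simp only [Function.comp, hi] at this
    exact absurd (h₁ _ h) (by omega)
  have hf1 : f 1 = c₂ := by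
    by_contra h
    have h10 : f 1 ≠ c₁ := fun hh => by
      have := hfb.1 (hh.trans hf0.symm); simp at this
    obtain ⟨i, hi⟩ := hfb.2 c₂
    have h0 : (1 : Fin (m + 2)) < i := by
      have hi0 : i ≠ 0 := by rintro rfl; exact hne (hf0.symm.trans hi)
      have hi1 : i ≠ 1 := by rintro rfl; exact h hi
      rw [Fin.lt_def]
      have a : (i : ℕ) ≠ 0 := fun h => hi0 (Fin.ext h)
      have b : (i : ℕ) ≠ 1 := fun h => hi1 (Fin.ext (by simpa using h))
      have : ((1 : Fin (m + 2)) : ℕ) = 1 := by simp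
      omega
    have := hf h0
    simp only [Function.comp, hi] at this
    exact absurd (h₂ _ h10 h) (by omega)
  have hfo : ∀ i : Fin (m + 2), i ≠ 0 → f i ≠ c₁ := fun i hi hh => hi (hfb.1 (hh.trans hf0.symm))
  have hfo' : ∀ i : Fin (m + 2), i ≠ 1 → f i ≠ c₂ := fun i hi hh => hi (hfb.1 (hh.trans hf1.symm))
  -- Dropping the first row leaves `c₂` followed by the other points. Their images under `q` list
  -- `C'` by increasing `key'`, so this list has to be the sorting permutation `σ'`.
  let h : Fin (m + 1) → C' := fun i => q (f i.succ)
  have hh : StrictMono (key' ∘ h) := by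
    intro i j hij
    have hj0 : j.succ ≠ 0 := Fin.succ_ne_zero j
    have hjp : j ≠ 0 := by rintro rfl; exact absurd hij (by simp)
    have hj1 : j.succ ≠ 1 := by
      intro h; apply hjp; apply Fin.succ_injective; simpa using h
    by_cases hi : i = 0
    · subst hi
      have : h 0 = q c₁ := by
        change q (f (Fin.succ 0)) = q c₁
        rw [hq, ← hf1]; rfl
      simp only [Function.comp, this]
      exact h₁' _ (hfo _ hj0) (hfo' _ hj1)
    · have hi1 : i.succ ≠ 1 := by
        intro h; apply hi; apply Fin.succ_injective; simpa using h
      exact hmono _ _ (hfo _ (Fin.succ_ne_zero i)) (hfo' _ hi1) (hfo _ hj0) (hfo' _ hj1)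
        (hf (Fin.succ_lt_succ_iff.2 hij))
  have hhi : Function.Injective h := fun a b hab => hh.injective (congrArg key' hab)
  have hhb : Function.Bijective h := by
    have : Fintype C' := Fintype.ofEquiv _ e'.symm
    exact (Fintype.bijective_iff_injective_and_card h).2 ⟨hhi, Fintype.card_congr e'.symm⟩
  have hk' : Function.Injective key' := by
    intro x y hxy
    obtain ⟨a, rfl⟩ := hhb.2 x
    obtain ⟨b, rfl⟩ := hhb.2 y
    exact congrArg h (hh.injective hxy)
  let π : Equiv.Perm (Fin (m + 1)) := (Equiv.ofBijective h hhb).trans e'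
  have hπ : π = σ' := by
    have := Tuple.unique_monotone (f := key' ∘ e'.symm) (σ := π) (τ := σ')
      (by
        have : (key' ∘ e'.symm) ∘ π = key' ∘ h := by
          funext i; simp [π]
        rw [this]; exact hh.monotone)
      (Tuple.monotone_sort _)
    ext i
    have hi := congrFun this i
    exact congrArg _ (e'.symm.injective (hk' hi))
  have hh' : ∀ i, h i = e'.symm (σ' i) := by
    intro i; rw [← hπ]; simp [π]
  set w : Fin (m + 2) → C → ℤ := Fin.cons v₀ fun j => v j ∘ q with hw
  set M : Matrix (Fin (m + 2)) (Fin (m + 2)) ℤ := of fun i j => w j (e.symm i) with hM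
  set N : Matrix (Fin (m + 1)) (Fin (m + 1)) ℤ := of fun i j => v j (e'.symm i) with hN
  have d1 : (M.submatrix σ id).det = (Equiv.Perm.sign σ : ℤ) * M.det := det_permute σ M
  have d2 : (N.submatrix σ' id).det = (Equiv.Perm.sign σ' : ℤ) * N.det := det_permute σ' N
  have d3 : (M.submatrix σ id).det = (v₀ c₁ - v₀ c₂) * (N.submatrix σ' id).det := by
    -- Subtracting the row of `c₂` from the row of `c₁` kills every entry but the first, because the
    -- other columns factor through `q`. Expansion along this row leaves the sorted matrix of `C'`.
    rw [← det_updateRow_add_smul_self (M.submatrix σ id) (i := 0) (j := 1) (by simp) (-1),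
      det_succ_row_zero, Finset.sum_eq_single 0]
    · have : (N.submatrix σ' id) = (updateRow (M.submatrix σ id) 0 ((M.submatrix σ id) 0 +
          (-1 : ℤ) • (M.submatrix σ id) 1)).submatrix Fin.succ (Fin.succAbove 0) := by
        ext i j
        simp only [submatrix_apply, updateRow_ne (Fin.succ_ne_zero i), hN, hM, of_apply, hw,
          Fin.succAbove_zero, id, Fin.cons_succ, Function.comp]
        rw [← hh']
      rw [this]
      have e0 : e.symm (σ 0) = c₁ := hf0
      have e1 : e.symm (σ 1) = c₂ := hf1
      simp [hM, hw, e0, e1, sub_eq_add_neg]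
    · intro j _ hj
      obtain ⟨j, rfl⟩ := Fin.exists_succ_eq.2 hj
      have e0 : e.symm (σ 0) = c₁ := hf0
      have e1 : e.symm (σ 1) = c₂ := hf1
      simp [hM, hw, e0, e1, hq]
    · simp
  have s1 : ((Equiv.Perm.sign σ : ℤˣ) : ℤ) * ((Equiv.Perm.sign σ : ℤˣ) : ℤ) = 1 := by
    rw [← Units.val_mul, Int.units_mul_self, Units.val_one]
  calc M.det = (Equiv.Perm.sign σ : ℤ) * ((Equiv.Perm.sign σ : ℤ) * M.det) := by
        rw [← mul_assoc, s1, one_mul]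
    _ = _ := by
        rw [← d1, d3, d2]
        simp only [orderSign, ← hσ, ← hσ', Units.val_mul]
        ring

end Determinant

end VirtualKhovanov

/-! ### Cycles of a state and the change of one smoothing -/

namespace VirtualKhovanov

theorem Corner.sum_eq {M : Type*} [AddCommMonoid M] (f : Corner → M) :
    ∑ x, f x = f .sw + f .se + f .ne + f .nw := by
  have : (Finset.univ : Finset Corner) = {.sw, .se, .ne, .nw} := rfl
  rw [this]
  rw [Finset.sum_insert (by decide), Finset.sum_insert (by decide), Finset.sum_insert (by decide),
    Finset.sum_singleton]
  simp only [add_assoc]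

namespace Diagram

variable {D : Diagram}

section Smoothing

variable {s t : D.State} {τ : Fin D.n}

theorem smooth_smooth (s : D.State) (h : D.HalfEdge) : D.smooth s (D.smooth s h) = h := by
  obtain ⟨c, x⟩ := h
  by_cases hv : D.Vertical s c <;> cases x <;> simp [smooth, hv]

theorem smooth_ne (s : D.State) (h : D.HalfEdge) : D.smooth s h ≠ h := by
  obtain ⟨c, x⟩ := h
  by_cases hv : D.Vertical s c <;> cases x <;> simp [smooth, hv]

theorem glue_ne (h : D.HalfEdge) : D.glue h ≠ h := by
  intro hh
  have := D.glue_incoming h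
  rw [hh] at this
  exact (iff_not_self this).elim

theorem smooth_congr (h : D.HalfEdge) (hh : s h.1 = t h.1) : D.smooth s h = D.smooth t h := by
  unfold smooth Vertical
  rw [hh]

theorem smooth_sw_of_vertical (hv : D.Vertical s τ) : D.smooth s (τ, .sw) = (τ, .nw) := by
  simp [smooth, hv]

theorem smooth_ne_of_vertical (hv : D.Vertical s τ) : D.smooth s (τ, .ne) = (τ, .se) := by
  simp [smooth, hv]

theorem smooth_sw_of_not_vertical (hv : ¬ D.Vertical s τ) :
    D.smooth s (τ, .sw) = (τ, .se) := by
  simp [smooth, hv]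

theorem smooth_ne_of_not_vertical (hv : ¬ D.Vertical s τ) :
    D.smooth s (τ, .ne) = (τ, .nw) := by
  simp [smooth, hv]

/-- The states `s` and `t` differ exactly at the crossing `τ`. -/
def Flip (τ : Fin D.n) (s t : D.State) : Prop := s τ ≠ t τ ∧ ∀ c, c ≠ τ → s c = t c

theorem Flip.symm (h : Flip τ s t) : Flip τ t s := ⟨h.1.symm, fun c hc => (h.2 c hc).symm⟩

theorem Flip.vertical_iff (h : Flip τ s t) : D.Vertical t τ ↔ ¬ D.Vertical s τ := by
  have := h.1
  unfold Vertical
  rcases hs : s τ <;> rcases ht : t τ <;> simp_all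

theorem Flip.smooth_eq (h : Flip τ s t) {a : D.HalfEdge} (ha : a.1 ≠ τ) :
    D.smooth s a = D.smooth t a := smooth_congr a (h.2 _ ha)

/-- Changing the smoothing at `τ` replaces the arcs `sw - y`, `ne - y'` by `sw - y'`, `ne - y`. -/
theorem Flip.exists_corners (h : Flip τ s t) : ∃ y y' : Corner,
    ((y = .nw ∧ y' = .se) ∨ (y = .se ∧ y' = .nw)) ∧
    D.smooth s (τ, .sw) = (τ, y) ∧ D.smooth s (τ, .ne) = (τ, y') ∧
    D.smooth t (τ, .sw) = (τ, y') ∧ D.smooth t (τ, .ne) = (τ, y) := by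
  by_cases hv : D.Vertical s τ
  · have ht : ¬ D.Vertical t τ := by rw [h.vertical_iff]; exact not_not.2 hv
    exact ⟨.nw, .se, Or.inl ⟨rfl, rfl⟩, smooth_sw_of_vertical hv, smooth_ne_of_vertical hv,
      smooth_sw_of_not_vertical ht, smooth_ne_of_not_vertical ht⟩
  · have ht : D.Vertical t τ := h.vertical_iff.2 hv
    exact ⟨.se, .nw, Or.inr ⟨rfl, rfl⟩, smooth_sw_of_not_vertical hv,
      smooth_ne_of_not_vertical hv, smooth_sw_of_vertical ht, smooth_ne_of_vertical ht⟩

/-- The cycle of `s` through the half-edge `h`. -/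
def loop (s : D.State) (h : D.HalfEdge) : D.Loop s := Quot.mk _ h

theorem loop_smooth (s : D.State) (h : D.HalfEdge) : loop s (D.smooth s h) = loop s h :=
  (Quot.sound (r := D.Step s) (Or.inl rfl)).symm

theorem loop_glue (s : D.State) (h : D.HalfEdge) : loop s (D.glue h) = loop s h :=
  (Quot.sound (r := D.Step s) (Or.inr rfl)).symm

/-- Induction along a cycle: an equivalence relation that contains the steps of `s` contains the
relation of lying on the same cycle. -/
theorem rel_of_loop_eq {R : D.HalfEdge → D.HalfEdge → Prop} (hR : Equivalence R)
    (hs : ∀ h, R h (D.smooth s h)) (hg : ∀ h, R h (D.glue h)) {a b : D.HalfEdge}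
    (hab : loop s a = loop s b) : R a b := by
  have := Quot.eqvGen_exact hab
  induction this with
  | rel x y h => rcases h with rfl | rfl; exacts [hs x, hg x]
  | refl x => exact hR.refl x
  | symm x y _ ih => exact hR.symm (ih (Quot.eqvGen_sound ‹_›))
  | trans x y z _ _ ih₁ ih₂ =>
    exact hR.trans (ih₁ (Quot.eqvGen_sound ‹_›)) (ih₂ (Quot.eqvGen_sound ‹_›))

theorem eq_of_loop_eq {α : Type*} {f : D.HalfEdge → α}
    (hs : ∀ h, f (D.smooth s h) = f h) (hg : ∀ h, f (D.glue h) = f h) {a b : D.HalfEdge}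
    (hab : loop s a = loop s b) : f a = f b :=
  rel_of_loop_eq (R := fun a b => f a = f b) ⟨fun _ => rfl, Eq.symm, Eq.trans⟩
    (fun h => (hs h).symm) (fun h => (hg h).symm) hab

/-- The half-edge `h` lies on a cycle of `s` through `τ`. -/
def Meets (s : D.State) (τ : Fin D.n) (h : D.HalfEdge) : Prop :=
  loop s h = loop s (τ, .sw) ∨ loop s h = loop s (τ, .ne)

/-- Two different cycles of `s` pass through `τ`. -/
def Dist (s : D.State) (τ : Fin D.n) : Prop := loop s (τ, .sw) ≠ loop s (τ, .ne)

theorem meets_corner (s : D.State) (τ : Fin D.n) (x : Corner) : Meets s τ (τ, x) := by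
  by_cases hv : D.Vertical s τ
  · cases x
    · exact Or.inl rfl
    · exact Or.inr (by rw [← smooth_ne_of_vertical hv, loop_smooth])
    · exact Or.inr rfl
    · exact Or.inl (by rw [← smooth_sw_of_vertical hv, loop_smooth])
  · cases x
    · exact Or.inl rfl
    · exact Or.inl (by rw [← smooth_sw_of_not_vertical hv, loop_smooth])
    · exact Or.inr rfl
    · exact Or.inr (by rw [← smooth_ne_of_not_vertical hv, loop_smooth])

theorem loop_corner_eq (hs : ¬ Dist s τ) (x : Corner) : loop s (τ, x) = loop s (τ, .sw) := by
  have hs : loop s (τ, .sw) = loop s (τ, .ne) := not_not.1 hs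
  rcases meets_corner s τ x with h | h
  · exact h
  · rw [h, hs]

/-- Cycles of `s` persist in `t` as far as they are not cut at `τ`. -/
theorem Flip.loop_eq_of_not_dist (hf : Flip τ s t) (ht : ¬ Dist t τ) {a b : D.HalfEdge}
    (hab : loop s a = loop s b) : loop t a = loop t b := by
  refine eq_of_loop_eq (f := loop t) (fun h => ?_) (loop_glue t) hab
  by_cases hh : h.1 = τ
  · obtain ⟨c, x⟩ := h
    obtain rfl : c = τ := hh
    exact (loop_corner_eq ht _).trans (loop_corner_eq ht x).symm
  · rw [hf.smooth_eq hh, loop_smooth]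

/-- Only the arcs at `τ` are exchanged, and all four corners of `τ` lie on cycles through `τ`; a
path in `t` therefore either survives in `s` or joins two such cycles. -/
theorem Flip.loop_eq_or_meets (hf : Flip τ s t) {a b : D.HalfEdge} (hab : loop t a = loop t b) :
    loop s a = loop s b ∨ (Meets s τ a ∧ Meets s τ b) := by
  refine rel_of_loop_eq (R := fun a b => loop s a = loop s b ∨ (Meets s τ a ∧ Meets s τ b))
    ⟨fun _ => Or.inl rfl, ?_, ?_⟩ ?_ (fun h => Or.inl (loop_glue s h).symm) hab
  · rintro x y (h | h)
    · exact Or.inl h.symm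
    · exact Or.inr h.symm
  · rintro x y z (h | h) (h' | h')
    · exact Or.inl (h.trans h')
    · exact Or.inr ⟨by unfold Meets at *; rw [h]; exact h'.1, h'.2⟩
    · exact Or.inr ⟨h.1, by unfold Meets at *; rw [← h']; exact h.2⟩
    · exact Or.inr ⟨h.1, h'.2⟩
  · intro h
    by_cases hh : h.1 = τ
    · obtain ⟨c, x⟩ := h
      obtain rfl : c = τ := hh
      exact Or.inr ⟨meets_corner s c x, meets_corner s c _⟩
    · rw [← hf.smooth_eq hh, loop_smooth]
      exact Or.inl rfl

/-- The union of the cycles through `τ` is the same set before and after the change. -/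
theorem Flip.meets (hf : Flip τ s t) {a : D.HalfEdge} (ha : Meets s τ a) : Meets t τ a := by
  rcases ha with h | h
  · rcases hf.symm.loop_eq_or_meets h with h | h
    exacts [Or.inl h, h.1]
  · rcases hf.symm.loop_eq_or_meets h with h | h
    exacts [Or.inr h, h.1]

theorem Flip.meets_iff (hf : Flip τ s t) {a : D.HalfEdge} : Meets t τ a ↔ Meets s τ a :=
  ⟨hf.symm.meets, hf.meets⟩

theorem Flip.loop_eq_of_not_meets (hf : Flip τ s t) {a b : D.HalfEdge} (ha : ¬ Meets s τ a)
    (hab : loop s a = loop s b) : loop t a = loop t b := by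
  rcases hf.symm.loop_eq_or_meets hab with h | h
  · exact h
  · exact (ha (hf.symm.meets h.1)).elim

end Smoothing

/-! ### Directions of the cycles -/

section Orientation

/-- A choice of directions of the cycles of `s`: a sign that changes along every arc. -/
structure IsOrientation (s : D.State) (o : D.HalfEdge → ℤˣ) : Prop where
  smooth : ∀ h, o (D.smooth s h) = - o h
  glue : ∀ h, o (D.glue h) = - o h

/-- The permutation that moves every half-edge by two steps along its cycle. -/
noncomputable def advance (s : D.State) : Equiv.Perm D.HalfEdge where
  toFun h := D.smooth s (D.glue h)
  invFun h := D.glue (D.smooth s h)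
  left_inv h := by simp only [smooth_smooth, D.glue_glue]
  right_inv h := by simp only [D.glue_glue, smooth_smooth]

theorem advance_apply (s : D.State) (h : D.HalfEdge) :
    advance s h = D.smooth s (D.glue h) := rfl

theorem advance_inv_apply (s : D.State) (h : D.HalfEdge) :
    (advance s)⁻¹ h = D.glue (D.smooth s h) := rfl

/-- Passing to the other end of a semi-arc reverses the direction of travel, so `glue` conjugates
`advance` to its inverse. -/
theorem glue_advance_zpow (s : D.State) (n : ℤ) (h : D.HalfEdge) :
    D.glue ((advance s ^ n) h) = (advance s ^ (-n)) (D.glue h) := by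
  induction n generalizing h with
  | zero => simp
  | succ i ih =>
    rw [zpow_add_one, Equiv.Perm.mul_apply, ih, advance_apply, neg_add, zpow_add, zpow_neg_one,
      Equiv.Perm.mul_apply, advance_inv_apply]
  | pred i ih =>
    rw [zpow_sub_one, Equiv.Perm.mul_apply, ih, advance_inv_apply, D.glue_glue, neg_sub,
      sub_neg_eq_add, add_comm, neg_neg, zpow_add_one, Equiv.Perm.mul_apply, advance_apply,
      D.glue_glue]

/-- A cycle has no point at which a traveller turns round: if `n` advances led from `h` to `glue h`,
the midpoint of this path would be fixed by `glue` for even `n` and by `smooth` for odd `n`. -/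
theorem not_sameCycle_glue (s : D.State) (h : D.HalfEdge) :
    ¬ (advance s).SameCycle h (D.glue h) := by
  rintro ⟨n, hn⟩
  obtain ⟨m, rfl | rfl⟩ := n.even_or_odd'
  · apply glue_ne ((advance s ^ m) h)
    rw [glue_advance_zpow, ← hn, ← Equiv.Perm.mul_apply, ← zpow_add]
    congr 2; ring
  · apply smooth_ne s (D.glue ((advance s ^ m) h))
    rw [← advance_apply, glue_advance_zpow, ← hn, ← Equiv.Perm.mul_apply, ← Equiv.Perm.mul_apply,
      ← zpow_add, ← zpow_one_add]
    congr 2; ring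

theorem SameCycle.glue {s : D.State} {a b : D.HalfEdge} (h : (advance s).SameCycle a b) :
    (advance s).SameCycle (D.glue a) (D.glue b) := by
  obtain ⟨n, rfl⟩ := h
  exact ⟨-n, (glue_advance_zpow s n a).symm⟩

theorem sameCycle_or_glue {s : D.State} {a b : D.HalfEdge} (h : loop s a = loop s b) :
    (advance s).SameCycle a b ∨ (advance s).SameCycle a (D.glue b) := by
  refine rel_of_loop_eq (R := fun a b =>
    (advance s).SameCycle a b ∨ (advance s).SameCycle a (D.glue b)) ⟨?_, ?_, ?_⟩ ?_ ?_ h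
  · exact fun x => Or.inl (Equiv.Perm.SameCycle.refl _ _)
  · rintro x y (h | h)
    · exact Or.inl h.symm
    · refine Or.inr ?_
      have := SameCycle.glue h
      rw [D.glue_glue] at this
      exact this.symm
  · rintro x y z (h | h) (h' | h')
    · exact Or.inl (h.trans h')
    · exact Or.inr (h.trans h')
    · exact Or.inr (h.trans (SameCycle.glue h'))
    · have := SameCycle.glue h'
      rw [D.glue_glue] at this
      exact Or.inl (h.trans this)
  · exact fun x => Or.inr ⟨-1, by rw [zpow_neg_one]; rfl⟩
  · exact fun x => Or.inr (by rw [D.glue_glue])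

-- The half-edges of a cycle form two orbits of `advance`, exchanged by `glue`. Give the sign 1 to
-- the orbit of a chosen representative and -1 to the other.
open Classical in
theorem exists_isOrientation (s : D.State) : ∃ o : D.HalfEdge → ℤˣ, IsOrientation s o := by
  have key : ∀ a b : D.HalfEdge, loop s a = loop s b →
      ((advance s).SameCycle a (D.glue b) ↔ ¬ (advance s).SameCycle a b) := fun a b hab =>
    ⟨fun h h' => not_sameCycle_glue s b (h'.symm.trans h),
      fun h => (sameCycle_or_glue hab).resolve_left h⟩
  let r : D.HalfEdge → D.HalfEdge := fun h => (loop s h).out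
  have hr : ∀ h, loop s (r h) = loop s h := fun h => Quot.out_eq (loop s h)
  let o : D.HalfEdge → ℤˣ := fun h => if (advance s).SameCycle (r h) h then 1 else -1
  have hg : ∀ h, o (D.glue h) = - o h := by
    intro h
    have e : r (D.glue h) = r h := by simp only [r, loop_glue]
    simp only [o, e, key _ _ (hr h)]
    split_ifs <;> simp_all
  have hadv : ∀ h, o (advance s h) = o h := by
    intro h
    have e : r (advance s h) = r h := by simp only [r, advance_apply, loop_smooth, loop_glue]
    simp only [o, e, Equiv.Perm.sameCycle_apply_right]
  refine ⟨o, fun h => ?_, hg⟩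
  rw [← hg h, ← hadv (D.glue h), advance_apply, D.glue_glue]

variable {s t : D.State} {τ : Fin D.n} {o : D.HalfEdge → ℤˣ}

theorem IsOrientation.advance_pow (ho : IsOrientation s o) (i : ℕ) (h : D.HalfEdge) :
    o ((advance s ^ i) h) = o h := by
  induction i with
  | zero => rfl
  | succ i ih => rw [pow_succ', Equiv.Perm.mul_apply, advance_apply, ho.smooth, ho.glue, ih, neg_neg]

/-- If one cycle passes twice through `τ` in the same direction, then it splits at `τ`. -/
theorem Flip.dist_of_orientation (hf : Flip τ s t) (ho : IsOrientation s o) (hs : ¬ Dist s τ)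
    (h : o (τ, .sw) = o (τ, .ne)) : Dist t τ := by
  classical
  set a : D.HalfEdge := (τ, .sw) with ha
  -- Follow the cycle from `sw` until it first returns to `τ`; it does return because `advance` has
  -- finite order.
  have hex : ∃ n, ((advance s ^ (n + 1)) a).1 = τ := by
    refine ⟨orderOf (advance s) - 1, ?_⟩
    rw [Nat.sub_add_cancel (orderOf_pos _), pow_orderOf_eq_one]
    rfl
  let n := Nat.find hex
  have hn : ((advance s ^ (n + 1)) a).1 = τ := Nat.find_spec hex
  have hmin : ∀ i, i < n → ((advance s ^ (i + 1)) a).1 ≠ τ := fun i hi => Nat.find_min hex hi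
  -- The half-edges on this excursion. Its only corners at `τ` are the start `a` and the last
  -- half-edge `z`.
  let f : D.HalfEdge → Prop := fun h =>
    ∃ i, i ≤ n ∧ (h = (advance s ^ i) a ∨ h = D.glue ((advance s ^ i) a))
  have hsucc : ∀ i, (advance s ^ (i + 1)) a = D.smooth s (D.glue ((advance s ^ i) a)) := fun i => by
    rw [pow_succ', Equiv.Perm.mul_apply, advance_apply]
  set z := D.glue ((advance s ^ n) a) with hz
  have hzτ : z.1 = τ := by rw [hsucc] at hn; exact hn
  have fcorner : ∀ h, f h → h.1 = τ → h = a ∨ h = z := by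
    rintro h ⟨i, hi, rfl | rfl⟩ hh
    · rcases i with _ | i
      · exact Or.inl rfl
      · exact (hmin i (by omega) hh).elim
    · rcases hi.lt_or_eq with hi | rfl
      · exact (hmin i hi (by rw [hsucc]; exact hh)).elim
      · exact Or.inr rfl
  have fa : f a := ⟨0, Nat.zero_le _, Or.inl rfl⟩
  have fz : f z := ⟨n, le_rfl, Or.inr rfl⟩
  have fg : ∀ h, f h → f (D.glue h) := by
    rintro h ⟨i, hi, rfl | rfl⟩
    · exact ⟨i, hi, Or.inr rfl⟩
    · exact ⟨i, hi, Or.inl (D.glue_glue _)⟩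
  have fs : ∀ h, h.1 ≠ τ → f h → f (D.smooth s h) := by
    rintro h hh ⟨i, hi, rfl | rfl⟩
    · rcases i with _ | i
      · exact (hh rfl).elim
      · rw [hsucc, smooth_smooth]
        exact ⟨i, by omega, Or.inr rfl⟩
    · rcases hi.lt_or_eq with hi | rfl
      · exact ⟨i + 1, hi, Or.inl (hsucc i).symm⟩
      · exact (hh hzτ).elim
  have oz : o z = - o a := by rw [hz, ho.glue, ho.advance_pow]
  have hane : ∀ u : ℤˣ, u ≠ -u := by decide
  -- `z` has the direction opposite to `a`, while `ne` has the same direction as `a` by hypothesis.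
  have hzne : z ≠ (τ, .ne) := by
    intro hh
    rw [hh, ← h] at oz
    exact hane _ oz
  have hza : z ≠ a := by
    intro hh; rw [hh] at oz; exact hane _ oz
  have fne : ¬ f (τ, .ne) := fun hh => by
    rcases fcorner _ hh rfl with h | h
    · simp [ha] at h
    · exact hzne h.symm
  -- A smoothing that joins `a` to `z` closes the excursion up into a cycle without `ne`. In `s`
  -- this is excluded by `hs`, so it is `t` that joins them.
  have sep : ∀ r : D.State, (∀ h : D.HalfEdge, h.1 ≠ τ → D.smooth r h = D.smooth s h) →
      D.smooth r a = z → Dist r τ := by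
    intro r hr hra hd
    have inv : ∀ h, f h → f (D.smooth r h) := by
      intro h hh
      by_cases hτ : h.1 = τ
      · rcases fcorner h hh hτ with rfl | rfl
        · rw [hra]; exact fz
        · rw [← hra, smooth_smooth]; exact fa
      · rw [hr h hτ]; exact fs h hτ hh
    have := eq_of_loop_eq (s := r) (f := f)
      (fun h => propext ⟨fun h' => by simpa [smooth_smooth] using inv _ h', inv h⟩)
      (fun h => propext ⟨fun h' => by simpa [D.glue_glue] using fg _ h', fg h⟩) hd
    exact fne (this.mp fa)
  obtain ⟨y, y', hy, s₁, s₂, t₁, t₂⟩ := hf.exists_corners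
  have hzc : z = (τ, y) ∨ z = (τ, y') := by
    have : ∀ x : Corner, x ≠ .ne → x ≠ .sw → x = y ∨ x = y' := by
      rcases hy with ⟨rfl, rfl⟩ | ⟨rfl, rfl⟩ <;> intro x <;> cases x <;> simp
    rcases this z.2 (fun h => hzne (Prod.ext hzτ h)) (fun h => hza (Prod.ext hzτ h)) with h | h
    exacts [Or.inl (Prod.ext hzτ h), Or.inr (Prod.ext hzτ h)]
  rcases hzc with hh | hh
  · exact (hs (sep s (fun _ _ => rfl) (s₁.trans hh.symm))).elim
  · exact sep t (fun h hτ => (hf.smooth_eq hτ).symm) (t₁.trans hh.symm)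

end Orientation

/-! ### Sums over corners; merges, splits and directions -/

section Stokes

variable {s t : D.State} {τ : Fin D.n} {o : D.HalfEdge → ℤˣ}

/-- A weight that changes sign along all arcs outside a set of crossings sums to zero over the
corners of these crossings. -/
theorem sum_corners_eq_zero (s : D.State) (w : D.HalfEdge → ℤ) (S : Finset (Fin D.n))
    (hg : ∀ h, w (D.glue h) = - w h) (hs : ∀ h : D.HalfEdge, h.1 ∉ S → w (D.smooth s h) = - w h) :
    ∑ c ∈ S, (w (c, .sw) + w (c, .se) + w (c, .ne) + w (c, .nw)) = 0 := by
  have h0 : ∑ h, w h = 0 := by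
    let e : Equiv.Perm D.HalfEdge := ⟨D.glue, D.glue, D.glue_glue, D.glue_glue⟩
    have := Equiv.sum_comp e w
    have h2 : ∑ h, w (e h) = - ∑ h, w h := by
      rw [← Finset.sum_neg_distrib]
      exact Finset.sum_congr rfl fun h _ => hg h
    omega
  rw [Fintype.sum_prod_type] at h0
  rw [← h0]
  simp only [Corner.sum_eq]
  refine Finset.sum_subset (Finset.subset_univ _) fun c _ hc => ?_
  have a := hs (c, .sw) hc
  have b := hs (c, .ne) hc
  by_cases hv : D.Vertical s c
  · rw [smooth_sw_of_vertical hv] at a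
    rw [smooth_ne_of_vertical hv] at b
    omega
  · rw [smooth_sw_of_not_vertical hv] at a
    rw [smooth_ne_of_not_vertical hv] at b
    omega

/-- Two different cycles through `τ` merge. -/
theorem Flip.not_dist (hf : Flip τ s t) (hs : Dist s τ) : ¬ Dist t τ := by
  classical
  intro ht
  obtain ⟨o, ho⟩ := exists_isOrientation s
  obtain ⟨y, y', hy, s₁, s₂, t₁, t₂⟩ := hf.exists_corners
  -- Directions on the intersection of a cycle of `s` with a cycle of `t`, both through `sw`. If
  -- both states had two cycles at `τ`, only the corner `sw` would lie in it, and the sum would be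
  -- ±1.
  let w : D.HalfEdge → ℤ := fun h =>
    if loop s h = loop s (τ, .sw) ∧ loop t h = loop t (τ, .sw) then (o h : ℤ) else 0
  have := sum_corners_eq_zero s w {τ}
    (fun h => by simp only [w, loop_glue, ho.glue]; split_ifs <;> simp)
    (fun h hh => by
      have hh : h.1 ≠ τ := by simpa using hh
      have e : loop t (D.smooth s h) = loop t h := by rw [hf.smooth_eq hh, loop_smooth]
      simp only [w, loop_smooth, e, ho.smooth]; split_ifs <;> simp)
  rw [Finset.sum_singleton] at this
  have hs' : loop s (τ, .ne) ≠ loop s (τ, .sw) := fun h => hs h.symm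
  have ht' : loop t (τ, .ne) ≠ loop t (τ, .sw) := fun h => ht h.symm
  have wne : w (τ, .ne) = 0 := if_neg fun h => hs' h.1
  have wy : w (τ, y) = 0 := if_neg fun h => ht' (by rw [← h.2, ← t₂, loop_smooth])
  have wy' : w (τ, y') = 0 := if_neg fun h => hs' (by rw [← h.1, ← s₂, loop_smooth])
  have wsw : w (τ, .sw) = o (τ, .sw) := if_pos ⟨rfl, rfl⟩
  have h0 : (o (τ, .sw) : ℤ) ≠ 0 := Units.ne_zero _
  rcases hy with ⟨rfl, rfl⟩ | ⟨rfl, rfl⟩ <;> omega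

/-- An orientation of `s` for which both cycles at `τ` have the source-sink direction is an
orientation of `t`. -/
theorem IsOrientation.flip (ho : IsOrientation s o) (hf : Flip τ s t)
    (h : o (τ, .sw) = o (τ, .ne)) : IsOrientation t o := by
  refine ⟨fun a => ?_, ho.glue⟩
  by_cases ha : a.1 = τ
  · obtain ⟨c, x⟩ := a
    obtain rfl : c = τ := ha
    obtain ⟨y, y', hy, s₁, s₂, t₁, t₂⟩ := hf.exists_corners
    have a₁ := ho.smooth (c, .sw)
    have a₂ := ho.smooth (c, .ne)
    have t₃ : D.smooth t (c, y') = (c, .sw) := by rw [← t₁, smooth_smooth]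
    have t₄ : D.smooth t (c, y) = (c, .ne) := by rw [← t₂, smooth_smooth]
    rw [s₁] at a₁
    rw [s₂] at a₂
    rcases hy with ⟨rfl, rfl⟩ | ⟨rfl, rfl⟩ <;> cases x <;> simp_all
  · rw [← hf.smooth_eq ha, ho.smooth]

/-- Two orientations of a state differ by a sign that is constant along each cycle. -/
theorem IsOrientation.mul_eq (ho : IsOrientation s o) {o' : D.HalfEdge → ℤˣ}
    (ho' : IsOrientation s o') {a b : D.HalfEdge} (h : loop s a = loop s b) :
    o a * o' a = o b * o' b :=
  eq_of_loop_eq (f := fun a => o a * o' a) (fun h => by rw [ho.smooth, ho'.smooth, neg_mul_neg])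
    (fun h => by rw [ho.glue, ho'.glue, neg_mul_neg]) h

/-- If `t` has two cycles through `τ` then every orientation of `s` has the same direction at both
passages of `τ`. -/
theorem IsOrientation.eq_of_dist (ho : IsOrientation s o) (hf : Flip τ s t) (ht : Dist t τ) :
    o (τ, .sw) = o (τ, .ne) := by
  classical
  obtain ⟨o', ho'⟩ := exists_isOrientation t
  -- Reverse cycles of `t` so that both passages of `τ` get the direction 1. The result also orients
  -- `s`, where a single cycle passes through `τ`, so `o` agrees with it there up to one sign.
  let o'' : D.HalfEdge → ℤˣ := fun h =>
    if loop t h = loop t (τ, .sw) then o' h * o' (τ, .sw) else o' h * o' (τ, .ne)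
  have ho'' : IsOrientation t o'' :=
    ⟨fun h => by simp only [o'', loop_smooth, ho'.smooth]; split_ifs <;> simp,
      fun h => by simp only [o'', loop_glue, ho'.glue]; split_ifs <;> simp⟩
  have e₁ : o'' (τ, .sw) = 1 := by simp [o'', Int.units_mul_self]
  have e₂ : o'' (τ, .ne) = 1 := by
    simp only [o'']
    rw [if_neg fun h => ht h.symm, Int.units_mul_self]
  have ho3 := ho''.flip hf.symm (e₁.trans e₂.symm)
  have := ho.mul_eq ho3 (not_not.1 (hf.symm.not_dist ht))
  simpa [e₁, e₂] using this

theorem Flip.dist_iff (hf : Flip τ s t) (ho : IsOrientation s o) :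
    Dist t τ ↔ ¬ Dist s τ ∧ o (τ, .sw) = o (τ, .ne) :=
  ⟨fun h => ⟨hf.symm.not_dist h, ho.eq_of_dist hf h⟩, fun h => hf.dist_of_orientation ho h.1 h.2⟩

end Stokes

end Diagram

end VirtualKhovanov

/-! ### Cut loci and the transport to marked points -/

namespace VirtualKhovanov

open Classical in
/-- The sign `1` at the corners that point into the crossing and `-1` at the others. -/
noncomputable def Convention.inSign (κ : Convention) (x : Corner) : ℤˣ :=
  if κ.PointsIn x then 1 else -1

theorem Convention.inSign_ne (κ : Convention) : κ.inSign .ne = κ.inSign .sw := rfl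

theorem Convention.inSign_nw (κ : Convention) : κ.inSign .nw = - κ.inSign .sw := by
  rcases h : κ.risingIn <;> simp [inSign, PointsIn, h]

theorem Convention.inSign_se (κ : Convention) : κ.inSign .se = - κ.inSign .sw :=
  κ.inSign_nw

namespace Diagram

variable {D : Diagram} {κ : Convention} {s t : D.State} {τ : Fin D.n} {o : D.HalfEdge → ℤˣ}

/-- Both smoothings join an end of one strand to an end of the other, which is why they inherit the
source-sink orientation. -/
theorem inSign_smooth (κ : Convention) (s : D.State) (h : D.HalfEdge) :
    κ.inSign (D.smooth s h).2 = - κ.inSign h.2 := by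
  obtain ⟨c, x⟩ := h
  by_cases hv : D.Vertical s c <;> cases x <;>
    simp [smooth, hv, κ.inSign_nw, κ.inSign_ne, κ.inSign_se]

open Classical in
theorem inSign_glue (κ : Convention) (h : D.HalfEdge) :
    κ.inSign (D.glue h).2 = - (-1) ^ (if D.Cut κ h then 1 else 0) * κ.inSign h.2 := by
  unfold Convention.inSign Cut
  by_cases h₁ : κ.PointsIn h.2 <;> by_cases h₂ : κ.PointsIn (D.glue h).2 <;> simp [h₁, h₂]

/-- The source-sink direction of `h`, measured against an orientation. -/
noncomputable def align (κ : Convention) (o : D.HalfEdge → ℤˣ) (h : D.HalfEdge) : ℤˣ :=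
  κ.inSign h.2 * o h

/-- Along a path, the source-sink direction relative to a direction of the cycle flips exactly at
the cut loci. This makes the parity of their number independent of the path. -/
theorem CutPath.neg_one_pow {a b : D.HalfEdge} {m : ℕ} (h : D.CutPath κ s a b m)
    (ho : IsOrientation s o) : (-1 : ℤˣ) ^ m = align κ o a * align κ o b := by
  induction h with
  | refl => rw [Int.units_mul_self, pow_zero]
  | smooth _ ih => rw [ih, align, align, align, inSign_smooth, ho.smooth, neg_mul_neg]
  | glue _ ih =>
    rw [pow_add, ih]
    simp only [align]
    rw [inSign_glue, ho.glue]
    simp only [neg_mul, mul_neg, neg_neg]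
    ac_rfl

theorem CutPath.trans {a b c : D.HalfEdge} {m n : ℕ} (h : D.CutPath κ s a b m)
    (h' : D.CutPath κ s b c n) : D.CutPath κ s a c (m + n) := by
  induction h' with
  | refl => exact h
  | smooth _ ih => exact ih.smooth
  | glue _ ih => rw [← add_assoc]; exact ih.glue

theorem exists_cutPath (κ : Convention) {a b : D.HalfEdge} (h : loop s a = loop s b) :
    ∃ m, D.CutPath κ s a b m := by
  have := Quot.eqvGen_exact h
  clear h
  suffices (∃ m, D.CutPath κ s a b m) ∧ ∃ m, D.CutPath κ s b a m from this.1
  induction this with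
  | rel x y h =>
    rcases h with rfl | rfl
    · refine ⟨⟨0, (CutPath.refl x).smooth⟩, ⟨0, ?_⟩⟩
      simpa only [smooth_smooth] using (CutPath.refl (κ := κ) (s := s) (D.smooth s x)).smooth
    · have := (CutPath.refl (κ := κ) (s := s) (D.glue x)).glue
      rw [D.glue_glue] at this
      exact ⟨⟨_, (CutPath.refl x).glue⟩, ⟨_, this⟩⟩
  | refl x => exact ⟨⟨0, .refl x⟩, ⟨0, .refl x⟩⟩
  | symm x y _ ih => exact ih.symm
  | trans x y z _ _ ih₁ ih₂ =>
    obtain ⟨⟨_, a⟩, ⟨_, b⟩⟩ := ih₁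
    obtain ⟨⟨_, c⟩, ⟨_, d⟩⟩ := ih₂
    exact ⟨⟨_, a.trans c⟩, ⟨_, d.trans b⟩⟩

theorem neg_one_pow_cutCount (ho : IsOrientation s o) {a b : D.HalfEdge}
    (h : loop s a = loop s b) :
    (-1 : ℤˣ) ^ D.cutCount κ s a b = align κ o a * align κ o b :=
  (Nat.sInf_mem (exists_cutPath κ h)).neg_one_pow ho

namespace GlobalChoice

variable (g : D.GlobalChoice)

theorem loop_star (s : D.State) (q : D.Loop s) : loop s (g.star s q) = q := g.star_mem s q

/-- The sign of the transport from `h` to the marked point of its cycle. -/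
noncomputable def transport (κ : Convention) (s : D.State) (h : D.HalfEdge) : ℤˣ :=
  (-1) ^ g.barsTo κ s h

theorem transport_eq (ho : IsOrientation s o) (h : D.HalfEdge) :
    g.transport κ s h = align κ o h * align κ o (g.star s (loop s h)) :=
  neg_one_pow_cutCount ho (g.loop_star s _).symm

/-- The marked point enters both factors and cancels. -/
theorem transport_mul (ho : IsOrientation s o) {a b : D.HalfEdge} (h : loop s a = loop s b) :
    g.transport κ s a * g.transport κ s b = align κ o a * align κ o b := by
  rw [g.transport_eq ho, g.transport_eq ho, h, mul_mul_mul_comm, Int.units_mul_self, mul_one]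

theorem transport_smooth (κ : Convention) (s : D.State) (h : D.HalfEdge) :
    g.transport κ s (D.smooth s h) = g.transport κ s h := by
  obtain ⟨o, ho⟩ := exists_isOrientation s
  rw [g.transport_eq ho, g.transport_eq ho, loop_smooth, align, inSign_smooth, ho.smooth,
    neg_mul_neg]
  rfl

end GlobalChoice

/-- Where `τ` is a merge or a split, the two states have a common orientation. -/
theorem Flip.exists_common_orientation (hf : Flip τ s t) (h : Dist s τ ∨ Dist t τ) :
    ∃ o, IsOrientation s o ∧ IsOrientation t o ∧ o (τ, .sw) = o (τ, .ne) := by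
  rcases h with h | h
  · obtain ⟨o, ho⟩ := exists_isOrientation t
    have e := ho.eq_of_dist hf.symm h
    exact ⟨o, ho.flip hf.symm e, ho, e⟩
  · obtain ⟨o, ho⟩ := exists_isOrientation s
    have e := ho.eq_of_dist hf h
    exact ⟨o, ho, ho.flip hf e, e⟩

/-- When the two passages have the same direction, `o` is near `τ` the source-sink orientation or
its reverse. -/
theorem align_corner (κ : Convention) (ho : IsOrientation s o) (h : o (τ, .sw) = o (τ, .ne))
    (x : Corner) : align κ o (τ, x) = align κ o (τ, .sw) := by
  have a₁ := ho.smooth (τ, .sw)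
  have a₂ := ho.smooth (τ, .ne)
  by_cases hv : D.Vertical s τ
  · rw [smooth_sw_of_vertical hv] at a₁
    rw [smooth_ne_of_vertical hv] at a₂
    cases x <;> simp [align, a₁, a₂, κ.inSign_nw, κ.inSign_ne, κ.inSign_se, h]
  · rw [smooth_sw_of_not_vertical hv] at a₁
    rw [smooth_ne_of_not_vertical hv] at a₂
    cases x <;> simp [align, a₁, a₂, κ.inSign_nw, κ.inSign_ne, κ.inSign_se, h]

section Arcs

/-- The sign `1` if the arc labelled `1` of the smoothing of `τ` contains the corner `sw`. -/
noncomputable def arcSign (κ : Convention) (s : D.State) (τ : Fin D.n) : ℤˣ :=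
  open Classical in
  if D.Vertical s τ then (if κ.leftFirst then 1 else -1) else (if κ.topFirst then -1 else 1)

theorem arcSign_congr (κ : Convention) (h : s τ = t τ) : arcSign κ s τ = arcSign κ t τ := by
  unfold arcSign Vertical
  rw [h]

/-- One of the two states is vertical and the other horizontal at the crossing, so the product
depends on the convention alone. The bigon signs need the convention to be the same at all
crossings. -/
theorem Flip.arcSign_mul (hf : Flip τ s t) {τ' : Fin D.n} {s' t' : D.State}
    (hf' : Flip τ' s' t') :
    arcSign κ s τ * arcSign κ t τ = arcSign κ s' τ' * arcSign κ t' τ' := by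
  have a := hf.vertical_iff
  have b := hf'.vertical_iff
  unfold arcSign
  by_cases h : D.Vertical s τ <;> by_cases h' : D.Vertical s' τ' <;> simp [a, b, h, h', mul_comm]

/-- The two labelled arcs at `τ` are those through `sw` and `ne`, in the order given by
`arcSign`. -/
theorem arc_cases (κ : Convention) (s : D.State) (τ : Fin D.n) :
    (arcSign κ s τ = 1 ∧ ∀ {α : Type} (f : D.HalfEdge → α), (∀ h, f (D.smooth s h) = f h) →
      f (D.arc₁ κ s τ) = f (τ, .sw) ∧ f (D.arc₂ κ s τ) = f (τ, .ne)) ∨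
    (arcSign κ s τ = -1 ∧ ∀ {α : Type} (f : D.HalfEdge → α), (∀ h, f (D.smooth s h) = f h) →
      f (D.arc₁ κ s τ) = f (τ, .ne) ∧ f (D.arc₂ κ s τ) = f (τ, .sw)) := by
  by_cases hv : D.Vertical s τ
  · have e : ∀ {α : Type} (f : D.HalfEdge → α), (∀ h, f (D.smooth s h) = f h) →
        f (τ, .se) = f (τ, .ne) := fun f hf => by rw [← smooth_ne_of_vertical hv, hf]
    by_cases hl : κ.leftFirst = true
    · exact Or.inl ⟨by simp [arcSign, hv, hl], fun f hf => by simp [arc₁, arc₂, hv, hl, e f hf]⟩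
    · exact Or.inr ⟨by simp [arcSign, hv, hl], fun f hf => by simp [arc₁, arc₂, hv, hl, e f hf]⟩
  · have e : ∀ {α : Type} (f : D.HalfEdge → α), (∀ h, f (D.smooth s h) = f h) →
        f (τ, .nw) = f (τ, .ne) := fun f hf => by rw [← smooth_ne_of_not_vertical hv, hf]
    by_cases hl : κ.topFirst = true
    · exact Or.inr ⟨by simp [arcSign, hv, hl], fun f hf => by simp [arc₁, arc₂, hv, hl, e f hf]⟩
    · exact Or.inl ⟨by simp [arcSign, hv, hl], fun f hf => by simp [arc₁, arc₂, hv, hl, e f hf]⟩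

theorem cycle_eq_iff (κ : Convention) (s : D.State) (τ : Fin D.n) :
    D.cycle₁ κ s τ ≠ D.cycle₂ κ s τ ↔ Dist s τ := by
  have h : D.cycle₁ κ s τ ≠ D.cycle₂ κ s τ ↔
      loop s (D.arc₁ κ s τ) ≠ loop s (D.arc₂ κ s τ) := Sum.inl_injective.ne_iff
  rw [h]
  rcases arc_cases κ s τ with ⟨-, h⟩ | ⟨-, h⟩
  · obtain ⟨a, b⟩ := h (loop s) (loop_smooth s)
    rw [a, b, Dist]
  · obtain ⟨a, b⟩ := h (loop s) (loop_smooth s)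
    rw [a, b, Dist, ne_comm]

theorem cycleAt_eq_iff {a b : D.HalfEdge} :
    D.cycleAt s a = D.cycleAt s b ↔ loop s a = loop s b := Sum.inl_injective.eq_iff

theorem meets_iff_cycle (κ : Convention) {h : D.HalfEdge} : Meets s τ h ↔
    D.cycleAt s h = D.cycle₁ κ s τ ∨ D.cycleAt s h = D.cycle₂ κ s τ := by
  unfold cycle₁ cycle₂
  rw [cycleAt_eq_iff, cycleAt_eq_iff]
  rcases arc_cases κ s τ with ⟨-, h⟩ | ⟨-, h⟩
  · obtain ⟨a, b⟩ := h (loop s) (loop_smooth s)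
    rw [a, b, Meets]
  · obtain ⟨a, b⟩ := h (loop s) (loop_smooth s)
    rw [a, b, Meets, or_comm]

theorem meets_of_fst (h : D.HalfEdge) (hh : h.1 = τ) : Meets s τ h := by
  obtain ⟨c, x⟩ := h
  obtain rfl : c = τ := hh
  exact meets_corner s c x

theorem arc_align {r : D.State} (ho : IsOrientation s o)
    (h : o (τ, .sw) = o (τ, .ne)) :
    align κ o (D.arc₁ κ r τ) = align κ o (τ, .sw) ∧
      align κ o (D.arc₂ κ r τ) = align κ o (τ, .sw) :=
  ⟨align_corner κ ho h _, align_corner κ ho h _⟩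

end Arcs

namespace GlobalChoice

variable (g : D.GlobalChoice)

theorem neg_one_pow_preBars (ho : IsOrientation s o) (hτ : o (τ, .sw) = o (τ, .ne))
    {h : D.HalfEdge} (hm : Meets s τ h) :
    (-1) ^ g.preBars κ s τ (D.cycleAt s h) * g.transport κ s h =
      align κ o h * align κ o (τ, .sw) := by
  obtain ⟨h₁, h₂⟩ := arc_align (κ := κ) (r := s) ho hτ
  unfold preBars
  split_ifs with c₁ c₂
  · refine (g.transport_mul ho (cycleAt_eq_iff.1 c₁).symm).trans ?_
    rw [h₁, mul_comm]
  · refine (g.transport_mul ho (cycleAt_eq_iff.1 c₂).symm).trans ?_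
    rw [h₂, mul_comm]
  · exact (((meets_iff_cycle κ).1 hm).elim c₁ c₂).elim

theorem preBars_of_not_meets {h : D.HalfEdge} (hm : ¬ Meets s τ h) :
    g.preBars κ s τ (D.cycleAt s h) = 0 := by
  rw [meets_iff_cycle κ, not_or] at hm
  rw [preBars, if_neg hm.1, if_neg hm.2]

theorem neg_one_pow_postBars (ho : IsOrientation t o) (hτ : o (τ, .sw) = o (τ, .ne))
    {h : D.HalfEdge} (hm : Meets t τ h) :
    (-1) ^ g.postBars κ s t τ (D.cycleAt t h) * g.transport κ t h =
      align κ o h * align κ o (τ, .sw) := by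
  obtain ⟨h₁, h₂⟩ := arc_align (κ := κ) (r := t) ho hτ
  unfold postBars
  split_ifs with c₁ c₂
  · refine (g.transport_mul ho (cycleAt_eq_iff.1 c₁).symm).trans ?_
    rw [h₁, mul_comm]
  · refine (g.transport_mul ho (cycleAt_eq_iff.1 c₂).symm).trans ?_
    rw [h₂, mul_comm]
  · exact (((meets_iff_cycle κ).1 hm).elim c₁ c₂).elim

/-- The bar corrections at both ends of an edge agree with the transport to marked points. -/
theorem bars_transport (hf : Flip τ s t) (hd : Dist s τ ∨ Dist t τ) (h : D.HalfEdge) :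
    (-1) ^ g.preBars κ s τ (D.cycleAt s h) * g.transport κ s h =
      (-1) ^ g.postBars κ s t τ (D.cycleAt t h) * g.transport κ t h := by
  obtain ⟨o, hs, ht, e⟩ := hf.exists_common_orientation hd
  by_cases hm : Meets s τ h
  · rw [g.neg_one_pow_preBars hs e hm, g.neg_one_pow_postBars ht e (hf.meets hm)]
  · have hm' : ¬ Meets t τ h := fun h => hm (hf.symm.meets h)
    rw [g.preBars_of_not_meets hm, pow_zero, one_mul]
    rw [meets_iff_cycle κ, not_or] at hm'
    rw [postBars.eq_def, if_neg hm'.1, if_neg hm'.2]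
    -- A cycle that misses `τ` is the same curve in both states, so each marked point lies on it in
    -- both, and the transports compose.
    have e₁ : loop t (g.star t (loop t h)) = loop t h := g.loop_star t _
    have e₂ : loop s (g.star t (loop t h)) = loop s h := by
      refine (hf.symm.loop_eq_of_not_meets ?_ e₁.symm).symm
      rwa [meets_iff_cycle κ, not_or]
    have e₃ : loop s (g.star s (loop s h)) = loop s h := g.loop_star s _
    have e₄ : loop t (g.star s (loop s h)) = loop t h :=
      (hf.loop_eq_of_not_meets hm e₃.symm).symm
    change _ = g.transport κ t (g.star s (loop s (g.star t (loop t h)))) * _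
    rw [e₂, g.transport_mul ht e₄, g.transport_eq hs, mul_comm]

theorem transport_arc (κ : Convention) (s : D.State) (τ : Fin D.n) :
    (g.transport κ s (D.arc₁ κ s τ) = g.transport κ s (τ, .sw) ∧
      g.transport κ s (D.arc₂ κ s τ) = g.transport κ s (τ, .ne) ∧
      D.cycle₁ κ s τ = D.cycleAt s (τ, .sw) ∧ D.cycle₂ κ s τ = D.cycleAt s (τ, .ne)) ∨
    (g.transport κ s (D.arc₁ κ s τ) = g.transport κ s (τ, .ne) ∧
      g.transport κ s (D.arc₂ κ s τ) = g.transport κ s (τ, .sw) ∧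
      D.cycle₁ κ s τ = D.cycleAt s (τ, .ne) ∧ D.cycle₂ κ s τ = D.cycleAt s (τ, .sw)) := by
  have hc : ∀ h, D.cycleAt s (D.smooth s h) = D.cycleAt s h := fun h =>
    cycleAt_eq_iff.2 (loop_smooth s h)
  rcases arc_cases κ s τ with ⟨-, h⟩ | ⟨-, h⟩
  · obtain ⟨a, b⟩ := h _ (g.transport_smooth κ s)
    obtain ⟨c, d⟩ := h _ hc
    exact Or.inl ⟨a, b, c, d⟩
  · obtain ⟨a, b⟩ := h _ (g.transport_smooth κ s)
    obtain ⟨c, d⟩ := h _ hc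
    exact Or.inr ⟨a, b, c, d⟩

end GlobalChoice

end Diagram

end VirtualKhovanov

/-! ### Linearity over multiplication by X -/

namespace VirtualKhovanov

namespace Diagram

variable {D : Diagram} {κ : Convention} {s t : D.State} {τ : Fin D.n}

section Points

variable (D) in
/-- The half-edges, together with one point on each free loop. -/
abbrev Point : Type := D.HalfEdge ⊕ Fin D.freeLoops

/-- The cycle of `s` through a point. -/
def pt (s : D.State) : D.Point → D.Cycle s
  | Sum.inl h => D.cycleAt s h
  | Sum.inr i => Sum.inr i

/-- The point `p` lies on a cycle of `s` through `τ`. -/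
def PointMeets (s : D.State) (τ : Fin D.n) : D.Point → Prop
  | Sum.inl h => Meets s τ h
  | Sum.inr _ => False

theorem pt_surjective (s : D.State) : Function.Surjective (pt s) := by
  rintro (q | i)
  · obtain ⟨h, rfl⟩ := Quot.exists_rep q
    exact ⟨Sum.inl h, rfl⟩
  · exact ⟨Sum.inr i, rfl⟩

theorem pointMeets_iff (κ : Convention) {p : D.Point} : PointMeets s τ p ↔
    pt s p = D.cycle₁ κ s τ ∨ pt s p = D.cycle₂ κ s τ := by
  rcases p with h | i
  · exact meets_iff_cycle κ
  · simp [PointMeets, pt, cycle₁, cycle₂, cycleAt]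

theorem Flip.pointMeets_iff (hf : Flip τ s t) {p : D.Point} :
    PointMeets t τ p ↔ PointMeets s τ p := by
  rcases p with h | i
  · exact hf.meets_iff
  · exact Iff.rfl

theorem Flip.pt_eq_of_not_meets (hf : Flip τ s t) {p p' : D.Point} (hp : ¬ PointMeets s τ p)
    (h : pt s p = pt s p') : pt t p = pt t p' := by
  rcases p with a | i <;> rcases p' with b | j
  · exact cycleAt_eq_iff.2 (hf.loop_eq_of_not_meets hp (cycleAt_eq_iff.1 h))
  · simp [pt, cycleAt] at h
  · simp [pt, cycleAt] at h
  · exact congrArg Sum.inr (Sum.inr_injective h)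

theorem agreeOff_iff {l : D.EnhancedState s} {l' : D.EnhancedState t} :
    AgreeOff κ τ l l' ↔ ∀ p, ¬ PointMeets s τ p → l' (pt t p) = l (pt s p) := by
  constructor
  · rintro ⟨h₁, h₂⟩ (h | i) hp
    · rw [VirtualKhovanov.Diagram.pointMeets_iff κ, not_or] at hp
      exact h₁ h hp.1 hp.2
    · exact h₂ i
  · refine fun h => ⟨fun a h₁ h₂ => h (Sum.inl a) fun h => ?_, fun i => h (Sum.inr i) fun h => h⟩
    exact ((VirtualKhovanov.Diagram.pointMeets_iff κ).1 h).elim h₁ h₂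

theorem pt_eq_cycle₁ (hs : ¬ Dist s τ) {p : D.Point} (hp : PointMeets s τ p) :
    pt s p = D.cycle₁ κ s τ := by
  have := not_not.1 ((cycle_eq_iff κ s τ).not.2 hs)
  rcases (VirtualKhovanov.Diagram.pointMeets_iff κ).1 hp with h | h
  · exact h
  · rw [h, this]

end Points

section Operators

variable (k : Type*) [CommRing k]

open Classical in
/-- Multiplication by `X` in the tensor factor of the cycle `c`. -/
noncomputable def mulX (c : D.Cycle s) : D.Chain k s →ₗ[k] D.Chain k s :=
  Finsupp.linearCombination k fun l : D.EnhancedState s =>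
    if l c = .one then Finsupp.single (Function.update l c .X) 1 else 0

open Classical in
theorem mulX_apply (c : D.Cycle s) (x : D.Chain k s) (m : D.EnhancedState s) :
    mulX k c x m = if m c = .X then x (Function.update m c .one) else 0 := by
  induction x using Finsupp.induction_linear with
  | zero => simp
  | add x y hx hy => rw [map_add, Finsupp.add_apply, hx, hy]; split_ifs <;> simp
  | single l a =>
    rw [mulX, Finsupp.linearCombination_single]
    by_cases hm : m c = .X
    · rw [if_pos hm]
      by_cases hl : l = Function.update m c .one
      · subst hl
        have : Function.update m c Label.X = m := by rw [← hm, Function.update_eq_self]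
        simp [this]
      · rw [Finsupp.single_apply, if_neg hl]
        split_ifs with h1
        · rw [Finsupp.smul_apply, Finsupp.single_apply, if_neg, smul_zero]
          rintro rfl
          apply hl
          rw [Function.update_idem, ← h1, Function.update_eq_self]
        · simp
    · rw [if_neg hm]
      split_ifs with h1
      · rw [Finsupp.smul_apply, Finsupp.single_apply, if_neg, smul_zero]
        rintro rfl
        simp at hm
      · simp

theorem barMap_apply (f : D.Cycle s → ℕ) (x : D.Chain k s) (m : D.EnhancedState s) :
    barMap k f x m = (∏ c, barCoeff k (m c) ^ f c) * x m := by
  induction x using Finsupp.induction_linear with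
  | zero => simp
  | add x y hx hy => rw [map_add, Finsupp.add_apply, hx, hy, Finsupp.add_apply, mul_add]
  | single l a =>
    rw [barMap, Finsupp.linearCombination_single, Finsupp.smul_apply]
    by_cases h : l = m
    · subst h; simp [mul_comm]
    · simp [h]

theorem siteMap_single_apply (l : D.EnhancedState s) (m : D.EnhancedState t) :
    siteMap k κ s t τ (Finsupp.single l 1) m = siteCoeff k κ τ l m := by
  classical
  rw [siteMap, Finsupp.linearCombination_single, one_smul, Finsupp.finsetSum_apply]
  simp [Finsupp.single_apply]

/-- The bar operation is an algebra map that sends X to -X. -/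
theorem barMap_mulX (f : D.Cycle s → ℕ) (c : D.Cycle s) (x : D.Chain k s) :
    barMap k f (mulX k c x) = ((((-1) ^ f c : ℤˣ)) : ℤ) • mulX k c (barMap k f x) := by
  classical
  ext m
  rw [Finsupp.smul_apply, barMap_apply, mulX_apply, mulX_apply, barMap_apply]
  split_ifs with h
  · have : ∏ d, barCoeff k (m d) ^ f d =
        (-1) ^ f c * ∏ d, barCoeff k (Function.update m c Label.one d) ^ f d := by
      rw [← Finset.mul_prod_erase _ _ (Finset.mem_univ c),
        ← Finset.mul_prod_erase (a := c) _ (fun d => barCoeff k (Function.update m c Label.one d) ^ f d)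
          (Finset.mem_univ c)]
      rw [Function.update_self, h]
      simp only [barCoeff, one_pow, one_mul]
      congr 1
      refine Finset.prod_congr rfl fun d hd => ?_
      rw [Function.update_of_ne (Finset.ne_of_mem_erase hd)]
    rw [this]
    simp [zsmul_eq_mul, mul_assoc]
  · simp

-- The matrix form of `siteMap_mulX`. At the site it says that m and Δ commute with multiplication
-- by X in any factor through `τ`; away from the site the map is the identity on the factor.
open Classical in
theorem siteCoeff_update (hf : Flip τ s t) (p : D.Point) (l : D.EnhancedState s)
    (m : D.EnhancedState t) :
    (if l (pt s p) = .one then siteCoeff k κ τ (Function.update l (pt s p) .X) m else 0) =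
      if m (pt t p) = .X then siteCoeff k κ τ l (Function.update m (pt t p) .one) else 0 := by
  have hfm := fun p => hf.pointMeets_iff (p := p)
  by_cases hp : PointMeets s τ p
  · have hp' : PointMeets t τ p := hf.pointMeets_iff.2 hp
    have a₁ : AgreeOff κ τ (Function.update l (pt s p) .X) m ↔ AgreeOff κ τ l m := by
      rw [agreeOff_iff, agreeOff_iff]
      refine forall₂_congr fun p' h' => ?_
      rw [Function.update_of_ne]
      rintro h
      rw [pointMeets_iff κ, h, ← pointMeets_iff κ] at h'
      exact h' hp
    have a₂ : AgreeOff κ τ l (Function.update m (pt t p) .one) ↔ AgreeOff κ τ l m := by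
      rw [agreeOff_iff, agreeOff_iff]
      refine forall₂_congr fun p' h' => ?_
      rw [Function.update_of_ne]
      rintro h
      rw [← hfm, pointMeets_iff κ, h, ← pointMeets_iff κ] at h'
      exact h' hp'
    unfold siteCoeff
    simp only [a₁, a₂, cycle_eq_iff]
    by_cases ha : AgreeOff κ τ l m
    swap
    · simp [ha]
    simp only [ha, if_true]
    by_cases hs : Dist s τ
    · simp only [hs, if_true]
      have ht := hf.not_dist hs
      have hc := (cycle_eq_iff κ s τ).2 hs
      rw [pt_eq_cycle₁ (κ := κ) ht hp', Function.update_self]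
      rcases (pointMeets_iff κ).1 hp with h | h
      · rw [h, Function.update_self, Function.update_of_ne hc.symm]
        cases l (D.cycle₁ κ s τ) <;> cases l (D.cycle₂ κ s τ) <;> cases m (D.cycle₁ κ t τ) <;>
          simp [mulCoeff]
      · rw [h, Function.update_self, Function.update_of_ne hc]
        cases l (D.cycle₁ κ s τ) <;> cases l (D.cycle₂ κ s τ) <;> cases m (D.cycle₁ κ t τ) <;>
          simp [mulCoeff]
    · simp only [hs, if_false]
      by_cases ht : Dist t τ
      · simp only [ht, if_true]
        have hc := (cycle_eq_iff κ t τ).2 ht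
        rw [pt_eq_cycle₁ (κ := κ) hs hp, Function.update_self]
        rcases (pointMeets_iff κ).1 hp' with h | h
        · rw [h, Function.update_self, Function.update_of_ne hc.symm]
          cases l (D.cycle₁ κ s τ) <;> cases m (D.cycle₁ κ t τ) <;> cases m (D.cycle₂ κ t τ) <;>
            simp [comulCoeff]
        · rw [h, Function.update_self, Function.update_of_ne hc]
          cases l (D.cycle₁ κ s τ) <;> cases m (D.cycle₁ κ t τ) <;> cases m (D.cycle₂ κ t τ) <;>
            simp [comulCoeff]
      · simp [ht]
  · have hp' : ¬ PointMeets t τ p := fun h => hp (hf.pointMeets_iff.1 h)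
    have a : (l (pt s p) = .one ∧ AgreeOff κ τ (Function.update l (pt s p) .X) m) ↔
        (m (pt t p) = .X ∧ AgreeOff κ τ l (Function.update m (pt t p) .one)) := by
      rw [agreeOff_iff, agreeOff_iff]
      constructor
      · rintro ⟨h₁, h₂⟩
        refine ⟨by simpa using h₂ p hp, fun p' h' => ?_⟩
        by_cases e : pt s p' = pt s p
        · rw [hf.pt_eq_of_not_meets h' e, Function.update_self, e, h₁]
        · have e' : pt t p' ≠ pt t p := fun h =>
            e (hf.symm.pt_eq_of_not_meets (by rwa [hfm]) h)
          rw [Function.update_of_ne e', h₂ p' h', Function.update_of_ne e]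
      · rintro ⟨h₁, h₂⟩
        refine ⟨by simpa using (h₂ p hp).symm, fun p' h' => ?_⟩
        by_cases e : pt s p' = pt s p
        · rw [hf.pt_eq_of_not_meets h' e, e, Function.update_self, h₁]
        · have e' : pt t p' ≠ pt t p := fun h =>
            e (hf.symm.pt_eq_of_not_meets (by rwa [hfm]) h)
          rw [Function.update_of_ne e, ← h₂ p' h', Function.update_of_ne e']
    unfold siteCoeff
    rw [pointMeets_iff κ, not_or] at hp hp'
    rw [Function.update_of_ne (Ne.symm hp.1), Function.update_of_ne (Ne.symm hp.2),
      Function.update_of_ne (Ne.symm hp'.1), Function.update_of_ne (Ne.symm hp'.2)]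
    rw [← ite_and, ← ite_and]
    simp only [a]

theorem siteMap_mulX (hf : Flip τ s t) (p : D.Point) (x : D.Chain k s) :
    siteMap k κ s t τ (mulX k (pt s p) x) = mulX k (pt t p) (siteMap k κ s t τ x) := by
  classical
  suffices siteMap k κ s t τ ∘ₗ mulX k (pt s p) = mulX k (pt t p) ∘ₗ siteMap k κ s t τ from
    LinearMap.congr_fun this x
  refine Finsupp.lhom_ext' fun l => LinearMap.ext_ring ?_
  ext m
  simp only [LinearMap.comp_apply, Finsupp.lsingle_apply]
  rw [mulX_apply, siteMap_single_apply, ← siteCoeff_update k hf p l m, mulX,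
    Finsupp.linearCombination_single, one_smul]
  split_ifs
  · rw [siteMap_single_apply]
  · simp

theorem siteMap_eq_zero (hs : ¬ Dist s τ) (ht : ¬ Dist t τ) : siteMap k κ s t τ = 0 := by
  refine Finsupp.lhom_ext' fun l => LinearMap.ext_ring ?_
  ext m
  simp only [LinearMap.comp_apply, Finsupp.lsingle_apply]
  rw [siteMap_single_apply, siteCoeff, if_neg ((cycle_eq_iff κ s τ).not.2 hs),
    if_neg ((cycle_eq_iff κ t τ).not.2 ht), ite_self]
  rfl

/-- The labelling of all cycles by `1`. -/
noncomputable def unit (s : D.State) : D.Chain k s := Finsupp.single (fun _ => .one) 1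

theorem barMap_unit (f : D.Cycle s → ℕ) : barMap k f (unit k s) = unit k s := by
  simp [barMap, unit, Finsupp.linearCombination_single, barCoeff]

theorem unit_apply_of_forall {m : D.EnhancedState s} (h : ∀ c, m c = .one) :
    unit k s m = 1 := by
  rw [funext h]; simp [unit]

theorem unit_apply_of_ne {m : D.EnhancedState s} {c : D.Cycle s} (h : m c ≠ .one) :
    unit k s m = 0 := by
  rw [unit, Finsupp.single_apply, if_neg]
  rintro rfl
  exact h rfl

theorem siteMap_unit_of_dist (hf : Flip τ s t) (hs : Dist s τ) :
    siteMap k κ s t τ (unit k s) = unit k t := by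
  classical
  ext m
  rw [unit, siteMap_single_apply, siteCoeff, if_pos ((cycle_eq_iff κ s τ).2 hs)]
  have ht := hf.not_dist hs
  by_cases ha : AgreeOff κ τ (fun _ : D.Cycle s => Label.one) m
  · rw [if_pos ha]
    rw [agreeOff_iff] at ha
    cases h : m (D.cycle₁ κ t τ)
    · rw [unit_apply_of_forall]
      · rfl
      · intro c
        obtain ⟨p, rfl⟩ := pt_surjective t c
        by_cases hp : PointMeets s τ p
        · rw [pt_eq_cycle₁ (κ := κ) ht (hf.pointMeets_iff.2 hp), h]
        · exact ha p hp
    · rw [unit_apply_of_ne k (c := D.cycle₁ κ t τ) (by simp [h])]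
      rfl
  · rw [if_neg ha]
    rw [agreeOff_iff] at ha
    push Not at ha
    obtain ⟨p, -, hp⟩ := ha
    rw [unit_apply_of_ne k hp]

theorem siteMap_unit_of_split (hf : Flip τ s t) (ht : Dist t τ) :
    siteMap k κ s t τ (unit k s) =
      mulX k (D.cycle₁ κ t τ) (unit k t) + mulX k (D.cycle₂ κ t τ) (unit k t) := by
  classical
  ext m
  have hs := hf.symm.not_dist ht
  have hc := (cycle_eq_iff κ t τ).2 ht
  rw [unit, siteMap_single_apply, siteCoeff, if_neg ((cycle_eq_iff κ s τ).not.2 hs),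
    if_pos hc, Finsupp.add_apply, mulX_apply, mulX_apply]
  by_cases ha : AgreeOff κ τ (fun _ : D.Cycle s => Label.one) m
  · rw [if_pos ha]
    rw [agreeOff_iff] at ha
    have hall : ∀ c, c ≠ D.cycle₁ κ t τ → c ≠ D.cycle₂ κ t τ → m c = .one := by
      intro c h₁ h₂
      obtain ⟨p, rfl⟩ := pt_surjective t c
      refine ha p fun hp => ?_
      exact ((pointMeets_iff κ).1 (hf.pointMeets_iff.2 hp)).elim h₁ h₂
    have u₁ : m (D.cycle₂ κ t τ) = .one →
        unit k t (Function.update m (D.cycle₁ κ t τ) .one) = 1 := fun h =>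
      unit_apply_of_forall k fun c => by
        by_cases h₁ : c = D.cycle₁ κ t τ
        · rw [h₁, Function.update_self]
        · rw [Function.update_of_ne h₁]
          by_cases h₂ : c = D.cycle₂ κ t τ
          exacts [h₂ ▸ h, hall c h₁ h₂]
    have u₂ : m (D.cycle₁ κ t τ) = .one →
        unit k t (Function.update m (D.cycle₂ κ t τ) .one) = 1 := fun h =>
      unit_apply_of_forall k fun c => by
        by_cases h₁ : c = D.cycle₂ κ t τ
        · rw [h₁, Function.update_self]
        · rw [Function.update_of_ne h₁]
          by_cases h₂ : c = D.cycle₁ κ t τ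
          exacts [h₂ ▸ h, hall c h₂ h₁]
    have z₁ : m (D.cycle₂ κ t τ) = .X →
        unit k t (Function.update m (D.cycle₁ κ t τ) .one) = 0 := fun h =>
      unit_apply_of_ne k (c := D.cycle₂ κ t τ) (by rw [Function.update_of_ne hc.symm, h]; simp)
    have z₂ : m (D.cycle₁ κ t τ) = .X →
        unit k t (Function.update m (D.cycle₂ κ t τ) .one) = 0 := fun h =>
      unit_apply_of_ne k (c := D.cycle₁ κ t τ) (by rw [Function.update_of_ne hc, h]; simp)
    cases h₁ : m (D.cycle₁ κ t τ) <;> cases h₂ : m (D.cycle₂ κ t τ) <;>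
      simp_all [comulCoeff]
  · rw [if_neg ha]
    rw [agreeOff_iff] at ha
    push Not at ha
    obtain ⟨p, hp, hm⟩ := ha
    rw [← hf.pointMeets_iff, pointMeets_iff κ, not_or] at hp
    rw [unit_apply_of_ne k (c := pt t p) (by rwa [Function.update_of_ne hp.1]),
      unit_apply_of_ne k (c := pt t p) (by rwa [Function.update_of_ne hp.2])]
    simp

end Operators

namespace GlobalChoice

variable (k : Type*) [CommRing k] (g : D.GlobalChoice)

/-- The sign of the transport from a point to the marked point of its cycle. -/
noncomputable def pointTransport (κ : Convention) (s : D.State) : D.Point → ℤˣ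
  | Sum.inl h => g.transport κ s h
  | Sum.inr _ => 1

/-- Multiplication by the generator `X` with the source-sink direction of the point `p`. -/
noncomputable def opX (κ : Convention) (s : D.State) (p : D.Point) :
    D.Chain k s →ₗ[k] D.Chain k s :=
  (g.pointTransport κ s p : ℤ) • mulX k (pt s p)

/-- The sign of an edge of the cube. -/
noncomputable def edgeSign (κ : Convention) (s t : D.State) (τ : Fin D.n) : ℤˣ :=
  orderSign (g.order t) (g.postKey κ s t τ) * orderSign (g.order s) (g.preKey κ s τ)

theorem partialDiff_apply (x : D.Chain k s) : g.partialDiff k κ s t τ x =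
    (g.edgeSign κ s t τ : ℤ) • barMap k (g.postBars κ s t τ)
      (siteMap k κ s t τ (barMap k (g.preBars κ s τ) x)) := rfl

/-- The bars of an edge compensate the change of the sign in `opX` between the two states. -/
theorem pointBars_transport (hf : Flip τ s t) (hd : Dist s τ ∨ Dist t τ) (p : D.Point) :
    (-1) ^ g.preBars κ s τ (pt s p) * g.pointTransport κ s p =
      (-1) ^ g.postBars κ s t τ (pt t p) * g.pointTransport κ t p := by
  rcases p with h | i
  · exact g.bars_transport hf hd h
  · have a : g.preBars κ s τ (pt s (Sum.inr i)) = 0 := by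
      simp [preBars, pt, cycle₁, cycle₂, cycleAt]
    have b : g.postBars κ s t τ (pt t (Sum.inr i)) = 0 := by
      simp [postBars.eq_def, pt, cycle₁, cycle₂, cycleAt]
    rw [a, b]
    rfl

theorem partialDiff_eq_zero (hs : ¬ Dist s τ) (ht : ¬ Dist t τ) :
    g.partialDiff k κ s t τ = 0 := by
  ext1 l
  ext1
  simp [partialDiff_apply, siteMap_eq_zero k hs ht]

/-- The partial differentials are linear over the algebra generated by the operators `opX`. -/
theorem partialDiff_opX (hf : Flip τ s t) (p : D.Point) (x : D.Chain k s) :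
    g.partialDiff k κ s t τ (g.opX k κ s p x) = g.opX k κ t p (g.partialDiff k κ s t τ x) := by
  by_cases hd : Dist s τ ∨ Dist t τ
  · have e := g.pointBars_transport (κ := κ) hf hd p
    have hu : ∀ a b c d : ℤˣ, b * a = d * c → (a : ℤ) * (b : ℤ) * (d : ℤ) = c := by
      intro a b c d h
      rw [← Units.val_mul, ← Units.val_mul, mul_comm a b, h, mul_comm d c, mul_assoc,
        Int.units_mul_self, mul_one]
    simp only [partialDiff_apply, opX, LinearMap.smul_apply, map_zsmul, barMap_mulX,
      siteMap_mulX k hf, smul_smul]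
    congr 1
    rw [← hu _ _ _ _ e]
    ring
  · rw [not_or] at hd
    rw [g.partialDiff_eq_zero k hd.1 hd.2]
    simp

theorem partialDiff_unit_of_dist (hf : Flip τ s t) (hs : Dist s τ) :
    g.partialDiff k κ s t τ (unit k s) = (g.edgeSign κ s t τ : ℤ) • unit k t := by
  rw [partialDiff_apply, barMap_unit, siteMap_unit_of_dist k hf hs, barMap_unit]

theorem partialDiff_unit_of_split (hf : Flip τ s t) (ht : Dist t τ) :
    g.partialDiff k κ s t τ (unit k s) = (g.edgeSign κ s t τ : ℤ) •
      (g.opX k κ t (Sum.inl (τ, .sw)) (unit k t) + g.opX k κ t (Sum.inl (τ, .ne)) (unit k t)) := by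
  rw [partialDiff_apply, barMap_unit, siteMap_unit_of_split k hf ht, map_add, barMap_mulX,
    barMap_mulX, barMap_unit]
  congr 1
  have hc := (cycle_eq_iff κ t τ).2 ht
  have b₁ : ((-1 : ℤˣ)) ^ g.postBars κ s t τ (D.cycle₁ κ t τ) = g.transport κ t (D.arc₁ κ t τ) := by
    rw [postBars.eq_def, if_pos rfl]; rfl
  have b₂ : ((-1 : ℤˣ)) ^ g.postBars κ s t τ (D.cycle₂ κ t τ) = g.transport κ t (D.arc₂ κ t τ) := by
    rw [postBars.eq_def, if_neg hc.symm, if_pos rfl]; rfl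
  rw [b₁, b₂]
  rcases g.transport_arc κ t τ with ⟨h₁, h₂, h₃, h₄⟩ | ⟨h₁, h₂, h₃, h₄⟩
  · rw [h₁, h₂, h₃, h₄]; rfl
  · rw [h₁, h₂, h₃, h₄, add_comm]; rfl

/-- A map that is linear over the operators `opX` is determined by its value at the labelling of
all cycles by `1`. -/
theorem ext_unit {F G : D.Chain k s →ₗ[k] D.Chain k t}
    (hF : ∀ p x, F (g.opX k κ s p x) = g.opX k κ t p (F x))
    (hG : ∀ p x, G (g.opX k κ s p x) = g.opX k κ t p (G x))
    (h : F (unit k s) = G (unit k s)) : F = G := by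
  classical
  refine Finsupp.lhom_ext' fun l => LinearMap.ext_ring ?_
  simp only [LinearMap.comp_apply, Finsupp.lsingle_apply]
  induction hn : (Finset.univ.filter fun c => l c = Label.X).card generalizing l with
  | zero =>
    have : l = fun _ => .one := by
      funext c
      rw [Finset.card_eq_zero, Finset.filter_eq_empty_iff] at hn
      have := hn (Finset.mem_univ c)
      cases hc : l c
      · rfl
      · exact (this hc).elim
    rw [this]; exact h
  | succ n ih =>
    obtain ⟨c, hc⟩ : (Finset.univ.filter fun c => l c = Label.X).Nonempty := by
      rw [← Finset.card_pos, hn]; omega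
    have hX : l c = .X := (Finset.mem_filter.1 hc).2
    have hl := ih (Function.update l c .one) (by
      have : (Finset.univ.filter fun d => Function.update l c Label.one d = Label.X) =
          (Finset.univ.filter fun c => l c = Label.X).erase c := by
        ext d
        by_cases hd : d = c
        · subst hd; simp
        · simp [hd]
      rw [this, Finset.card_erase_of_mem hc, hn]
      rfl)
    obtain ⟨p, rfl⟩ := pt_surjective s c
    -- A label X is obtained from 1 by `opX`, up to the transport sign, which is its own inverse.
    have e : Finsupp.single l (1 : k) = (g.pointTransport κ s p : ℤ) •
        g.opX k κ s p (Finsupp.single (Function.update l (pt s p) .one) 1) := by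
      rw [opX, LinearMap.smul_apply, smul_smul, ← Units.val_mul, Int.units_mul_self, Units.val_one,
        one_smul, mulX, Finsupp.linearCombination_single, if_pos (Function.update_self ..), one_smul,
        Function.update_idem, ← hX, Function.update_eq_self]
    rw [e, map_zsmul, map_zsmul, hF, hG, hl]

theorem opX_comm (p p' : D.Point) (x : D.Chain k s) :
    g.opX k κ s p (g.opX k κ s p' x) = g.opX k κ s p' (g.opX k κ s p x) := by
  classical
  simp only [opX, LinearMap.smul_apply, map_zsmul]
  rw [smul_comm]
  congr 2
  ext m
  simp only [mulX_apply]
  by_cases h : pt s p = pt s p'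
  · rw [h]
  · have h' : pt s p' ≠ pt s p := fun e => h e.symm
    rw [Function.update_of_ne h, Function.update_of_ne h', Function.update_comm h]
    split_ifs <;> rfl

end GlobalChoice

end Diagram

end VirtualKhovanov

/-! ### Edge signs as ratios of volumes -/

namespace VirtualKhovanov

theorem orderSign_trans_finCongr {α : Type*} {n m : ℕ} (e : α ≃ Fin n) (h : n = m)
    (key : α → ℕ) : orderSign (e.trans (finCongr h)) key = orderSign e key := by
  subst h; rfl

namespace Diagram

variable {D : Diagram} {κ : Convention} {s t P Q : D.State} {τ : Fin D.n}

theorem pt_eq_iff {a b : D.HalfEdge} :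
    pt s (Sum.inl a) = pt s (Sum.inl b) ↔ loop s a = loop s b := cycleAt_eq_iff

theorem Flip.pt_eq_of_not_dist (hf : Flip τ s t) (ht : ¬ Dist t τ) {p p' : D.Point}
    (h : pt s p = pt s p') : pt t p = pt t p' := by
  rcases p with a | i <;> rcases p' with b | j
  · exact cycleAt_eq_iff.2 (hf.loop_eq_of_not_dist ht (cycleAt_eq_iff.1 h))
  · simp [pt, cycleAt] at h
  · simp [pt, cycleAt] at h
  · exact congrArg Sum.inr (Sum.inr_injective h)

theorem Flip.pt_eq_or_meets (hf : Flip τ s t) {p p' : D.Point} (h : pt t p = pt t p') :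
    pt s p = pt s p' ∨ (PointMeets s τ p ∧ PointMeets s τ p') := by
  rcases p with a | i <;> rcases p' with b | j
  · rw [pt_eq_iff]; exact hf.loop_eq_or_meets (cycleAt_eq_iff.1 h)
  · simp [pt, cycleAt] at h
  · simp [pt, cycleAt] at h
  · exact Or.inl (congrArg Sum.inr (Sum.inr_injective h))

/-- The function `v` is constant on the cycles of `s`. -/
def Inv (s : D.State) (v : D.Point → ℤ) : Prop := ∀ p p', pt s p = pt s p' → v p = v p'

theorem Inv.of_flip {v : D.Point → ℤ} (hv : Inv t v) (hf : Flip τ s t) (ht : ¬ Dist t τ) :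
    Inv s v := fun p p' h => hv p p' (hf.pt_eq_of_not_dist ht h)

open Classical in
/-- The indicator function of a cycle. -/
noncomputable def indicator (s : D.State) (c : D.Cycle s) (p : D.Point) : ℤ :=
  if pt s p = c then 1 else 0

theorem inv_indicator (s : D.State) (c : D.Cycle s) : Inv s (indicator s c) := by
  intro p p' h
  unfold indicator
  rw [h]

/-- The difference of the values of `v` at the corners `sw` and `ne` of `τ`. -/
def diffAt (τ : Fin D.n) (v : D.Point → ℤ) : ℤ := v (Sum.inl (τ, .sw)) - v (Sum.inl (τ, .ne))

theorem diffAt_indicator (hs : Dist s τ) :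
    diffAt τ (indicator s (pt s (Sum.inl (τ, .sw)))) = 1 := by
  have : pt s (Sum.inl (τ, .ne)) ≠ pt s (Sum.inl (τ, .sw)) := fun h => hs (pt_eq_iff.1 h.symm)
  simp [diffAt, indicator, this]

theorem inv_diff_arc {v : D.Point → ℤ} (hv : Inv s v) :
    v (Sum.inl (D.arc₁ κ s τ)) - v (Sum.inl (D.arc₂ κ s τ)) =
      (arcSign κ s τ : ℤ) * diffAt τ v := by
  have hs : ∀ h, v (Sum.inl (D.smooth s h)) = v (Sum.inl h) := fun h =>
    hv _ _ (pt_eq_iff.2 (loop_smooth s h))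
  rcases arc_cases κ s τ with ⟨e, h⟩ | ⟨e, h⟩
  · obtain ⟨a, b⟩ := h (fun h => v (Sum.inl h)) hs
    simp only [a, b, e, diffAt, Units.val_one, one_mul]
  · obtain ⟨a, b⟩ := h (fun h => v (Sum.inl h)) hs
    simp only [a, b, e, diffAt, Units.val_neg, Units.val_one, neg_mul, one_mul, neg_sub]

namespace GlobalChoice

variable (g : D.GlobalChoice)

/-- A point on each cycle. -/
def rep (s : D.State) : D.Cycle s → D.Point
  | Sum.inl q => Sum.inl (g.star s q)
  | Sum.inr i => Sum.inr i

theorem pt_rep (s : D.State) (c : D.Cycle s) : pt s (g.rep s c) = c := by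
  rcases c with q | i
  · exact congrArg Sum.inl (g.star_mem s q)
  · rfl

theorem carry_eq (s t : D.State) (c : D.Cycle t) : g.carry s t c = pt s (g.rep t c) := by
  rcases c with q | i <;> rfl

theorem carry_pt_of_not_dist (hf : Flip τ P Q) (hQ : ¬ Dist Q τ) (p : D.Point) :
    g.carry Q P (pt P p) = pt Q p := by
  rw [carry_eq]
  exact hf.pt_eq_of_not_dist hQ (g.pt_rep P _)

theorem carry_pt_of_not_meets (hf : Flip τ s t) {p : D.Point} (hp : ¬ PointMeets t τ p) :
    g.carry s t (pt t p) = pt s p := by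
  rw [carry_eq]
  exact (hf.symm.pt_eq_of_not_meets hp (g.pt_rep t _).symm).symm

theorem carry_surjective (hf : Flip τ P Q) (hQ : ¬ Dist Q τ) :
    Function.Surjective (g.carry Q P) := fun c => by
  obtain ⟨p, rfl⟩ := pt_surjective Q c
  exact ⟨pt P p, g.carry_pt_of_not_dist hf hQ p⟩

/-- Merging identifies no cycles other than those through `τ`. -/
theorem carry_eq_carry (hf : Flip τ P Q) (hQ : ¬ Dist Q τ) {c d : D.Cycle P}
    (h : g.carry Q P c = g.carry Q P d) : c = d ∨
      ((c = D.cycle₁ κ P τ ∨ c = D.cycle₂ κ P τ) ∧ (d = D.cycle₁ κ P τ ∨ d = D.cycle₂ κ P τ)) := by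
  obtain ⟨p, rfl⟩ := pt_surjective P c
  obtain ⟨p', rfl⟩ := pt_surjective P d
  rw [g.carry_pt_of_not_dist hf hQ, g.carry_pt_of_not_dist hf hQ] at h
  rw [← pointMeets_iff, ← pointMeets_iff]
  exact hf.pt_eq_or_meets h

theorem carry_cycle (hf : Flip τ P Q) (hQ : ¬ Dist Q τ) :
    g.carry Q P (D.cycle₁ κ P τ) = D.cycle₁ κ Q τ ∧
      g.carry Q P (D.cycle₂ κ P τ) = D.cycle₁ κ Q τ :=
  ⟨(g.carry_pt_of_not_dist hf hQ (Sum.inl (D.arc₁ κ P τ))).trans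
      (pt_eq_cycle₁ hQ (meets_of_fst _ rfl)),
    (g.carry_pt_of_not_dist hf hQ (Sum.inl (D.arc₂ κ P τ))).trans
      (pt_eq_cycle₁ hQ (meets_of_fst _ rfl))⟩

theorem card_of_dist (g : D.GlobalChoice) (hf : Flip τ P Q) (hP : Dist P τ) :
    Fintype.card (D.Cycle P) = Fintype.card (D.Cycle Q) + 1 := by
  classical
  have hQ := hf.not_dist hP
  -- Any convention serves; it only names the two cycles through `τ`.
  have κ : Convention := ⟨true, true, true⟩
  have hc := (cycle_eq_iff κ P τ).2 hP
  obtain ⟨c₁, c₂⟩ := g.carry_cycle (κ := κ) hf hQ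
  -- Without one of the two merging cycles, `carry` becomes a bijection.
  have h : Finset.image (g.carry Q P) (Finset.univ.erase (D.cycle₂ κ P τ)) = Finset.univ := by
    ext c
    simp only [Finset.mem_image, Finset.mem_erase, Finset.mem_univ, and_true, iff_true]
    obtain ⟨d, rfl⟩ := g.carry_surjective hf hQ c
    by_cases hd : d = D.cycle₂ κ P τ
    · exact ⟨_, hc, by rw [hd, c₁, c₂]⟩
    · exact ⟨d, hd, rfl⟩
  have h' := congrArg Finset.card h
  rw [Finset.card_image_of_injOn, Finset.card_erase_of_mem (Finset.mem_univ _),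
    Finset.card_univ, Finset.card_univ] at h'
  · have : 0 < Fintype.card (D.Cycle P) := Fintype.card_pos_iff.2 ⟨D.cycle₁ κ P τ⟩
    omega
  · intro c hc d hd hcd
    simp only [Finset.coe_erase, Finset.coe_univ, Set.mem_sdiff, Set.mem_univ, true_and,
      Set.mem_singleton_iff] at hc hd
    rcases g.carry_eq_carry (κ := κ) hf hQ hcd with h | ⟨h₁, h₂⟩
    · exact h
    · rw [h₁.resolve_right hc, h₂.resolve_right hd]

theorem card_of_not_dist (g : D.GlobalChoice) (hf : Flip τ s t) (hs : ¬ Dist s τ) (ht : ¬ Dist t τ) :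
    Fintype.card (D.Cycle s) = Fintype.card (D.Cycle t) := by
  refine le_antisymm (Fintype.card_le_of_surjective _ (g.carry_surjective hf.symm hs))
    (Fintype.card_le_of_surjective _ (g.carry_surjective hf ht))

/-- The determinant of the values of functions on the cycles of `s` in their global order. -/
noncomputable def vol (s : D.State) {n : ℕ} (hn : Fintype.card (D.Cycle s) = n)
    (v : Fin n → D.Point → ℤ) : ℤ :=
  (Matrix.of fun i j => v j (g.rep s (((g.order s).trans (finCongr hn)).symm i))).det

theorem vol_swap {n : ℕ} (hn : Fintype.card (D.Cycle s) = n + 2) (a b : D.Point → ℤ)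
    (v : Fin n → D.Point → ℤ) :
    g.vol s hn (Fin.cons a (Fin.cons b v)) = - g.vol s hn (Fin.cons b (Fin.cons a v)) := by
  unfold vol
  have := Matrix.det_permute' (Equiv.swap (0 : Fin (n + 2)) 1) (Matrix.of fun i j =>
    (Fin.cons b (Fin.cons a v) : Fin (n + 2) → D.Point → ℤ) j
      (g.rep s (((g.order s).trans (finCongr hn)).symm i)))
  rw [Equiv.Perm.sign_swap (by simp)] at this
  simp only [Units.val_neg, Units.val_one, Int.cast_neg, Int.cast_one, neg_mul, one_mul] at this
  rw [← this]
  congr 1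
  ext i j
  simp only [Matrix.submatrix_apply, Matrix.of_apply, id]
  refine Fin.cases ?_ (fun j => ?_) j
  · rw [Equiv.swap_apply_left]; rfl
  · refine Fin.cases ?_ (fun j => ?_) j
    · rw [show Fin.succ (0 : Fin (n + 1)) = 1 from rfl, Equiv.swap_apply_right]; rfl
    · rw [Equiv.swap_apply_of_ne_of_ne (Fin.succ_ne_zero _)]
      · rfl
      · intro h
        exact Fin.succ_ne_zero j (Fin.succ_injective _ h)

/-- The indicators of the cycles, taken in the global order, have the identity matrix. -/
theorem exists_vol_eq_one (s : D.State) {n : ℕ} (hn : Fintype.card (D.Cycle s) = n) :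
    ∃ v : Fin n → D.Point → ℤ, (∀ j, Inv s (v j)) ∧ g.vol s hn v = 1 := by
  classical
  refine ⟨fun j => indicator s (((g.order s).trans (finCongr hn)).symm j),
    fun j => inv_indicator s _, ?_⟩
  rw [vol, ← Matrix.det_one (n := Fin n) (R := ℤ)]
  congr 1
  ext i j
  simp only [Matrix.of_apply, indicator, g.pt_rep, Matrix.one_apply, EmbeddingLike.apply_eq_iff_eq]

/-- The sign `ε` compares the global orders of the cycles of `P` and of the state `Q` in which two
cycles of `P` through `τ` are merged. -/
def EdgeRel (P Q : D.State) (τ : Fin D.n) (ε : ℤˣ) : Prop :=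
  ∀ (n : ℕ) (hP : Fintype.card (D.Cycle P) = n + 1) (hQ : Fintype.card (D.Cycle Q) = n)
    (v₀ : D.Point → ℤ) (v : Fin n → D.Point → ℤ), Inv P v₀ → (∀ j, Inv Q (v j)) →
    g.vol P hP (Fin.cons v₀ v) = (ε : ℤ) * diffAt τ v₀ * g.vol Q hQ v

/-- Common form of merges and splits: `f` is the relative order that the two keys share on the
cycles missing `τ`. Passing from the labelled arcs to the corners `sw`, `ne` costs the factor
`arcSign`. -/
theorem edgeRel_of_keys (hf : Flip τ P Q) (hP : Dist P τ)
    (key : D.Cycle P → ℕ) (key' : D.Cycle Q → ℕ) (f : D.Cycle P → ℕ)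
    (h₁ : key (D.cycle₁ κ P τ) = 0) (h₂ : key (D.cycle₂ κ P τ) = 1)
    (h₃ : key' (D.cycle₁ κ Q τ) = 0)
    (h₄ : ∀ c, c ≠ D.cycle₁ κ P τ → c ≠ D.cycle₂ κ P τ → key c = 2 + f c)
    (h₅ : ∀ c, c ≠ D.cycle₁ κ P τ → c ≠ D.cycle₂ κ P τ → key' (g.carry Q P c) = 2 + f c)
    (h₆ : ∀ c d, c ≠ D.cycle₁ κ P τ → c ≠ D.cycle₂ κ P τ → f c = f d → c = d) :
    g.EdgeRel P Q τ (orderSign (g.order P) key * orderSign (g.order Q) key' *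
      arcSign κ P τ) := by
  intro n hnP hnQ v₀ v hv₀ hv
  have hQ := hf.not_dist hP
  have hc := (cycle_eq_iff κ P τ).2 hP
  obtain ⟨c₁, c₂⟩ := g.carry_cycle (κ := κ) hf hQ
  have key_inj : Function.Injective key := by
    intro c d hcd
    by_cases a₁ : c = D.cycle₁ κ P τ
    · by_cases b₁ : d = D.cycle₁ κ P τ
      · rw [a₁, b₁]
      · by_cases b₂ : d = D.cycle₂ κ P τ
        · rw [a₁, b₂, h₁, h₂] at hcd; omega
        · rw [a₁, h₁, h₄ d b₁ b₂] at hcd; omega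
    · by_cases a₂ : c = D.cycle₂ κ P τ
      · by_cases b₁ : d = D.cycle₁ κ P τ
        · rw [a₂, b₁, h₁, h₂] at hcd; omega
        · by_cases b₂ : d = D.cycle₂ κ P τ
          · rw [a₂, b₂]
          · rw [a₂, h₂, h₄ d b₁ b₂] at hcd; omega
      · by_cases b₁ : d = D.cycle₁ κ P τ
        · rw [b₁, h₁, h₄ c a₁ a₂] at hcd; omega
        · by_cases b₂ : d = D.cycle₂ κ P τ
          · rw [b₂, h₂, h₄ c a₁ a₂] at hcd; omega
          · rw [h₄ d b₁ b₂, h₄ c a₁ a₂] at hcd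
            exact h₆ c d a₁ a₂ (by omega)
  have := det_eq_of_identify ((g.order P).trans (finCongr hnP)) ((g.order Q).trans (finCongr hnQ))
    (g.carry Q P) (D.cycle₁ κ P τ) (D.cycle₂ κ P τ) hc (c₁.trans c₂.symm) key key' key_inj
    (fun x hx => by
      by_cases hx₂ : x = D.cycle₂ κ P τ
      · rw [hx₂, h₁, h₂]; omega
      · rw [h₁, h₄ x hx hx₂]; omega)
    (fun x hx hx₂ => by rw [h₂, h₄ x hx hx₂]; omega)
    (fun x hx hx₂ => by rw [c₁, h₃, h₅ x hx hx₂]; omega)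
    (fun x y hx hx₂ hy hy₂ h => by rwa [h₅ x hx hx₂, h₅ y hy hy₂, ← h₄ x hx hx₂, ← h₄ y hy hy₂])
    (fun c => v₀ (g.rep P c)) (fun j c => v j (g.rep Q c))
  rw [orderSign_trans_finCongr, orderSign_trans_finCongr] at this
  have e₁ : v₀ (g.rep P (D.cycle₁ κ P τ)) = v₀ (Sum.inl (D.arc₁ κ P τ)) := hv₀ _ _ (g.pt_rep P _)
  have e₂ : v₀ (g.rep P (D.cycle₂ κ P τ)) = v₀ (Sum.inl (D.arc₂ κ P τ)) := hv₀ _ _ (g.pt_rep P _)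
  rw [e₁, e₂, inv_diff_arc hv₀] at this
  have e₃ : g.vol P hnP (Fin.cons v₀ v) = ((orderSign (g.order P) key * orderSign (g.order Q) key' :
      ℤˣ) : ℤ) * ((arcSign κ P τ : ℤ) * diffAt τ v₀) * g.vol Q hnQ v := by
    rw [vol, vol, ← this]
    congr 1
    ext i j
    simp only [Matrix.of_apply]
    refine Fin.cases rfl (fun j => ?_) j
    simp only [Fin.cons_succ, Function.comp]
    refine hv j _ _ ?_
    rw [g.pt_rep, g.carry_eq]
  rw [e₃]
  push_cast
  ring

theorem edgeRel_of_merge (κ : Convention) (hf : Flip τ s t) (hs : Dist s τ) :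
    g.EdgeRel s t τ (g.edgeSign κ s t τ * arcSign κ s τ) := by
  have hc := (cycle_eq_iff κ s τ).2 hs
  have ht := hf.not_dist hs
  rw [edgeSign, mul_comm (orderSign _ _)]
  refine g.edgeRel_of_keys (κ := κ) hf hs _ _ (fun c => (g.order s c : ℕ)) ?_ ?_ ?_ ?_ ?_ ?_
  · rw [preKey, if_pos rfl]
  · rw [preKey, if_neg hc.symm, if_pos rfl]
  · rw [postKey, if_pos rfl]
  · intro c h₁ h₂
    rw [preKey, if_neg h₁, if_neg h₂]
  · intro c h₁ h₂
    obtain ⟨p, rfl⟩ := pt_surjective s c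
    have hp : ¬ PointMeets t τ p := by
      rw [hf.pointMeets_iff, pointMeets_iff κ, not_or]; exact ⟨h₁, h₂⟩
    have hp' := hp
    rw [pointMeets_iff κ, not_or] at hp'
    rw [g.carry_pt_of_not_dist hf ht, postKey, if_neg hp'.1, if_neg hp'.2,
      g.carry_pt_of_not_meets hf hp]
  · intro c d _ _ h
    exact (g.order s).injective (Fin.ext h)

theorem edgeRel_of_split (κ : Convention) (hf : Flip τ s t) (ht : Dist t τ) :
    g.EdgeRel t s τ (g.edgeSign κ s t τ * arcSign κ t τ) := by
  have hc := (cycle_eq_iff κ t τ).2 ht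
  have hs := hf.symm.not_dist ht
  obtain ⟨c₁, c₂⟩ := g.carry_cycle (κ := κ) hf.symm hs
  have key : ∀ c, c ≠ D.cycle₁ κ t τ → c ≠ D.cycle₂ κ t τ → ∀ d, g.carry s t c = g.carry s t d →
      c = d := fun c h₁ h₂ d h => by
    rcases g.carry_eq_carry (κ := κ) hf.symm hs h with h | h
    · exact h
    · exact (h.1.elim h₁ h₂).elim
  refine g.edgeRel_of_keys (κ := κ) hf.symm ht _ _
    (fun c => (g.order s (g.carry s t c) : ℕ)) ?_ ?_ ?_ ?_ ?_ ?_
  · rw [postKey, if_pos rfl]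
  · rw [postKey, if_neg hc.symm, if_pos rfl]
  · rw [preKey, if_pos rfl]
  · intro c h₁ h₂
    rw [postKey, if_neg h₁, if_neg h₂]
  · intro c h₁ h₂
    have hn : g.carry s t c ≠ D.cycle₁ κ s τ := fun h => h₁ (key c h₁ h₂ _ (h.trans c₁.symm))
    have hn₂ : D.cycle₂ κ s τ = D.cycle₁ κ s τ :=
      (not_not.1 ((cycle_eq_iff κ s τ).not.2 hs)).symm
    rw [preKey, if_neg hn, if_neg (hn₂ ▸ hn)]
  · intro c d h₁ h₂ h
    exact key c h₁ h₂ d ((g.order s).injective (Fin.ext h))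

variable {τ₁ τ₂ : Fin D.n}

/-- Two independent merges contribute opposite signs in the two orders. -/
theorem EdgeRel.diamond {P Q₁ Q₂ R : D.State} {ε₁ ε₂ δ₁ δ₂ : ℤˣ}
    (f₁ : Flip τ₁ P Q₁) (f₂ : Flip τ₂ Q₁ R) (f₂' : Flip τ₂ P Q₂) (f₁' : Flip τ₁ Q₂ R)
    (d₁ : Dist P τ₁) (d₂ : Dist Q₁ τ₂) (d₂' : Dist P τ₂) (d₁' : Dist Q₂ τ₁)
    (r₁ : g.EdgeRel P Q₁ τ₁ ε₁) (r₂ : g.EdgeRel Q₁ R τ₂ ε₂)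
    (r₂' : g.EdgeRel P Q₂ τ₂ δ₂) (r₁' : g.EdgeRel Q₂ R τ₁ δ₁) :
    ε₁ * ε₂ = - (δ₂ * δ₁) := by
  obtain ⟨n, hR⟩ : ∃ n, Fintype.card (D.Cycle R) = n := ⟨_, rfl⟩
  have hQ₁ : Fintype.card (D.Cycle Q₁) = n + 1 := by rw [g.card_of_dist f₂ d₂, hR]
  have hQ₂ : Fintype.card (D.Cycle Q₂) = n + 1 := by rw [g.card_of_dist f₁' d₁', hR]
  have hP : Fintype.card (D.Cycle P) = n + 2 := by rw [g.card_of_dist f₁ d₁, hQ₁]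
  obtain ⟨v, hv, hvol⟩ := g.exists_vol_eq_one R hR
  have i₁ := inv_indicator Q₂ (pt Q₂ (Sum.inl (τ₁, .sw)))
  have i₂ := inv_indicator Q₁ (pt Q₁ (Sum.inl (τ₂, .sw)))
  have e₁ := diffAt_indicator d₁'
  have e₂ := diffAt_indicator d₂
  set u₁ := indicator Q₂ (pt Q₂ (Sum.inl (τ₁, .sw)))
  set u₂ := indicator Q₁ (pt Q₁ (Sum.inl (τ₂, .sw)))
  -- The volume of `P` on `u₁, u₂, v` is computed through `Q₁`, that on `u₂, u₁, v` through `Q₂`.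
  -- Both covectors take the value 1 on their own indicator, so the results are ε₁ε₂ and δ₂δ₁.
  have a := r₁ _ hP hQ₁ u₁ (Fin.cons u₂ v) (i₁.of_flip f₂' (f₂'.not_dist d₂'))
    (Fin.cases i₂ fun j => (hv j).of_flip f₂ (f₂.not_dist d₂))
  have b := r₂' _ hP hQ₂ u₂ (Fin.cons u₁ v) (i₂.of_flip f₁ (f₁.not_dist d₁))
    (Fin.cases i₁ fun j => (hv j).of_flip f₁' (f₁'.not_dist d₁'))
  rw [r₂ _ hQ₁ hR u₂ v i₂ hv, e₁, e₂, hvol] at a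
  rw [r₁' _ hQ₂ hR u₁ v i₁ hv, e₁, e₂, hvol] at b
  rw [g.vol_swap, b] at a
  apply Units.ext
  push_cast
  linarith

end GlobalChoice

/-! ### Two cycles merged and split again -/

/-- In `r`, the cycles through `τ₁` and `τ₂` are the same two; they are matched by the corners
`sw` and `ne` if `u = 1` and the other way round if `u = -1`. -/
def Match (r : D.State) (τ₁ τ₂ : Fin D.n) (u : ℤˣ) : Prop :=
  (u = 1 ∧ loop r (τ₂, .sw) = loop r (τ₁, .sw) ∧ loop r (τ₂, .ne) = loop r (τ₁, .ne)) ∨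
  (u = -1 ∧ loop r (τ₂, .sw) = loop r (τ₁, .ne) ∧ loop r (τ₂, .ne) = loop r (τ₁, .sw))

/-- The change at `τ₁` joins the two cycles through `τ₂`; this is possible only if they are the two
cycles through `τ₁`. -/
theorem exists_match {r r₁ : D.State} {τ₁ τ₂ : Fin D.n} (hf : Flip τ₁ r r₁)
    (hr : Dist r τ₂) (hr₁ : ¬ Dist r₁ τ₂) : ∃ u, Match r τ₁ τ₂ u := by
  rcases hf.loop_eq_or_meets (not_not.1 hr₁) with h | ⟨h | h, h' | h'⟩
  · exact (hr h).elim
  · exact (hr (h.trans h'.symm)).elim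
  · exact ⟨1, Or.inl ⟨rfl, h, h'⟩⟩
  · exact ⟨-1, Or.inr ⟨rfl, h, h'⟩⟩
  · exact (hr (h.trans h'.symm)).elim

theorem Match.of_flip {r r' : D.State} {τ₁ τ₂ : Fin D.n} {u : ℤˣ} (h : Match r τ₁ τ₂ u)
    (hf : Flip τ r r') (hr : ¬ Dist r' τ) : Match r' τ₁ τ₂ u := by
  rcases h with ⟨h, a, b⟩ | ⟨h, a, b⟩
  · exact Or.inl ⟨h, hf.loop_eq_of_not_dist hr a, hf.loop_eq_of_not_dist hr b⟩
  · exact Or.inr ⟨h, hf.loop_eq_of_not_dist hr a, hf.loop_eq_of_not_dist hr b⟩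

theorem Match.diffAt {r : D.State} {τ₁ τ₂ : Fin D.n} {u : ℤˣ} (h : Match r τ₁ τ₂ u)
    {v : D.Point → ℤ} (hv : Inv r v) : diffAt τ₂ v = u * diffAt τ₁ v := by
  rcases h with ⟨rfl, a, b⟩ | ⟨rfl, a, b⟩
  · simp only [Diagram.diffAt, hv _ _ (pt_eq_iff.2 a), hv _ _ (pt_eq_iff.2 b), Units.val_one,
      one_mul]
  · simp only [Diagram.diffAt, hv _ _ (pt_eq_iff.2 a), hv _ _ (pt_eq_iff.2 b), Units.val_neg,
      Units.val_one, neg_mul, one_mul, neg_sub]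

section Bigon

variable {τ₁ τ₂ : Fin D.n} {r r₁ r₂ r₁₂ : D.State} {u v : ℤˣ}

/-- If two cycles are merged and split again in two ways, the signs of the four edges are
determined by the matchings of the cycles. -/
theorem GlobalChoice.EdgeRel.bigon (g : D.GlobalChoice) {ε₁ ε₂ δ₁ δ₂ : ℤˣ}
    (f₁ : Flip τ₁ r r₁) (f₂ : Flip τ₂ r₁ r₁₂) (f₂' : Flip τ₂ r r₂)
    (d₁ : Dist r τ₁) (d₂ : Dist r τ₂) (d₁' : Dist r₁₂ τ₁) (d₂' : Dist r₁₂ τ₂)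
    (hu : Match r τ₁ τ₂ u) (hv : Match r₁₂ τ₁ τ₂ v)
    (e₁ : g.EdgeRel r r₁ τ₁ ε₁) (e₂ : g.EdgeRel r₁₂ r₁ τ₂ ε₂)
    (e₂' : g.EdgeRel r r₂ τ₂ δ₂) (e₁' : g.EdgeRel r₁₂ r₂ τ₁ δ₁) :
    ε₁ * ε₂ * (δ₂ * δ₁) = u * v := by
  obtain ⟨n, c₁⟩ : ∃ n, Fintype.card (D.Cycle r₁) = n := ⟨_, rfl⟩
  have c : Fintype.card (D.Cycle r) = n + 1 := by rw [g.card_of_dist f₁ d₁, c₁]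
  have c₂ : Fintype.card (D.Cycle r₂) = n := by
    have := g.card_of_dist f₂' d₂; omega
  have c₁₂ : Fintype.card (D.Cycle r₁₂) = n + 1 := by
    rw [g.card_of_dist f₂.symm d₂', c₁]
  obtain ⟨w, hw, hvol⟩ := g.exists_vol_eq_one r₁ c₁
  have n₁ : ¬ Dist r₁ τ₁ := f₁.not_dist d₁
  have n₂ : ¬ Dist r₁ τ₂ := f₂.symm.not_dist d₂'
  -- Both crossings merge the same two cycles of `r`, so functions on the cycles of `r₁` are also
  -- functions on those of `r₂`, and one family `w` serves both.
  have hw₂ : ∀ j, Inv r₂ (w j) := by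
    intro j p p' h
    refine hw j p p' ?_
    rcases f₂'.pt_eq_or_meets h with h | ⟨h, h'⟩
    · exact f₁.pt_eq_of_not_dist n₁ h
    · have key : ∀ p, PointMeets r τ₂ p → pt r₁ p = pt r₁ (Sum.inl (τ₂, .sw)) := by
        rintro (a | i) h
        · rcases h with h | h
          · exact f₁.pt_eq_of_not_dist n₁ (pt_eq_iff.2 h)
          · exact (f₁.pt_eq_of_not_dist n₁ (pt_eq_iff.2 h)).trans
              (pt_eq_iff.2 (not_not.1 n₂).symm)
        · exact h.elim
      rw [key p h, key p' h']
  have i := inv_indicator r (pt r (Sum.inl (τ₁, .sw)))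
  have i' := inv_indicator r₁₂ (pt r₁₂ (Sum.inl (τ₁, .sw)))
  have a := e₁ n c c₁ _ w i hw
  have a' := e₂' n c c₂ _ w i hw₂
  have b := e₂ n c₁₂ c₁ _ w i' hw
  have b' := e₁' n c₁₂ c₂ _ w i' hw₂
  rw [a, hu.diffAt i, diffAt_indicator d₁, hvol] at a'
  rw [b, hv.diffAt i', diffAt_indicator d₁', hvol] at b'
  have sq : ∀ x : ℤˣ, (x : ℤ) * x = 1 := fun x => by
    rw [← Units.val_mul, Int.units_mul_self, Units.val_one]
  have h₂ : g.vol r₂ c₂ w = δ₁ * ε₂ * v := by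
    have := congrArg (fun z => (δ₁ : ℤ) * z) b'
    simp only [mul_one, ← mul_assoc, sq, one_mul] at this
    exact this.symm
  rw [h₂] at a'
  apply Units.ext
  push_cast
  simp only [mul_one] at a'
  rw [a']
  calc (δ₂ : ℤ) * u * (δ₁ * ε₂ * v) * ε₂ * (δ₂ * δ₁)
      = (δ₂ * δ₂) * (δ₁ * δ₁) * (ε₂ * ε₂) * (u * v) := by ring
    _ = u * v := by rw [sq, sq, sq]; ring

/-- The matchings of two cycles that are merged and split again are related by the directions of
the cycles at the two crossings. -/
theorem match_mul_match {o : D.HalfEdge → ℤˣ} (hτ : τ₁ ≠ τ₂)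
    (f₁ : Flip τ₁ r r₁) (f₂ : Flip τ₂ r₁ r₁₂)
    (d₁ : Dist r τ₁) (d₁' : Dist r₁₂ τ₁) (d₂' : Dist r₁₂ τ₂)
    (hu : Match r τ₁ τ₂ u) (hv : Match r₁₂ τ₁ τ₂ v) (ho : IsOrientation r₁ o) :
    u * v * (o (τ₁, .sw) * o (τ₂, .sw)) = -1 := by
  classical
  have o₂ := ho.eq_of_dist f₂ d₂'
  -- Directions on the intersection of a cycle of `r` with a cycle of `r₁₂`. Away from `τ₁` and `τ₂`
  -- the arcs of all three states agree, so only these two crossings contribute.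
  let w : D.HalfEdge → ℤ := fun h =>
    if loop r h = loop r (τ₁, .sw) ∧ loop r₁₂ h = loop r₁₂ (τ₁, .sw) then (o h : ℤ) else 0
  have hsum := sum_corners_eq_zero r w {τ₁, τ₂}
    (fun h => by simp only [w, loop_glue, ho.glue]; split_ifs <;> simp)
    (fun h hh => by
      simp only [Finset.mem_insert, Finset.mem_singleton, not_or] at hh
      have e₁ : D.smooth r h = D.smooth r₁ h := f₁.smooth_eq hh.1
      have e₂ : D.smooth r₁ h = D.smooth r₁₂ h := f₂.smooth_eq hh.2
      have e : loop r₁₂ (D.smooth r h) = loop r₁₂ h := by rw [e₁, e₂, loop_smooth]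
      have e' : o (D.smooth r h) = - o h := by rw [e₁, ho.smooth]
      simp only [w, loop_smooth, e, e']; split_ifs <;> simp)
  rw [Finset.sum_pair hτ] at hsum
  have sum₁ : w (τ₁, .sw) + w (τ₁, .se) + w (τ₁, .ne) + w (τ₁, .nw) = o (τ₁, .sw) := by
    obtain ⟨y, y', hy, s₁, s₂, t₁, t₂⟩ := f₁.exists_corners
    rw [f₂.smooth_eq hτ] at t₁ t₂
    have wne : w (τ₁, .ne) = 0 := if_neg fun h => d₁ h.1.symm
    have wy : w (τ₁, y) = 0 := if_neg fun h => d₁' (by rw [← h.2, ← t₂, loop_smooth])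
    have wy' : w (τ₁, y') = 0 := if_neg fun h => d₁ (by rw [← h.1, ← s₂, loop_smooth])
    have wsw : w (τ₁, .sw) = o (τ₁, .sw) := if_pos ⟨rfl, rfl⟩
    rcases hy with ⟨rfl, rfl⟩ | ⟨rfl, rfl⟩ <;> omega
  -- Exactly one corner of `τ₂` lies in the intersection: `sw` or `ne` if the matchings agree,
  -- otherwise one of the other two, which have the opposite direction.
  have sum₂ : w (τ₂, .sw) + w (τ₂, .se) + w (τ₂, .ne) + w (τ₂, .nw) =
      ((u * v * o (τ₂, .sw) : ℤˣ) : ℤ) := by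
    obtain ⟨y, y', hy, s₁, s₂, t₁, t₂⟩ := f₂.exists_corners
    have oy : o (τ₂, y) = - o (τ₂, .sw) := by rw [← s₁, ho.smooth]
    have oy' : o (τ₂, y') = - o (τ₂, .sw) := by rw [← s₂, ho.smooth, o₂]
    have ly : loop r (τ₂, y) = loop r (τ₂, .sw) := by
      rw [← s₁, ← f₁.smooth_eq hτ.symm, loop_smooth]
    have ly' : loop r (τ₂, y') = loop r (τ₂, .ne) := by
      rw [← s₂, ← f₁.smooth_eq hτ.symm, loop_smooth]
    have my : loop r₁₂ (τ₂, y) = loop r₁₂ (τ₂, .ne) := by rw [← t₂, loop_smooth]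
    have my' : loop r₁₂ (τ₂, y') = loop r₁₂ (τ₂, .sw) := by rw [← t₁, loop_smooth]
    have total : w (τ₂, .sw) + w (τ₂, .se) + w (τ₂, .ne) + w (τ₂, .nw) =
        w (τ₂, .sw) + w (τ₂, y) + w (τ₂, .ne) + w (τ₂, y') := by
      rcases hy with ⟨rfl, rfl⟩ | ⟨rfl, rfl⟩ <;> ring
    have n₁ : loop r (τ₁, .ne) ≠ loop r (τ₁, .sw) := d₁.symm
    have n₂ : loop r₁₂ (τ₁, .ne) ≠ loop r₁₂ (τ₁, .sw) := d₁'.symm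
    rw [total]
    simp only [w, ly, ly', my, my', oy, oy', ← o₂]
    rcases hu with ⟨rfl, a, b⟩ | ⟨rfl, a, b⟩ <;> rcases hv with ⟨rfl, c, d⟩ | ⟨rfl, c, d⟩ <;>
      simp [a, b, c, d, n₁, n₂]
  rw [sum₁, sum₂] at hsum
  have : (o (τ₁, .sw)) = - (u * v * o (τ₂, .sw)) := by
    apply Units.ext
    rw [Units.val_neg]
    omega
  rw [this, neg_mul, mul_assoc (u * v), Int.units_mul_self, mul_one, mul_neg, Int.units_mul_self]

end Bigon

end Diagram

end VirtualKhovanov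

/-! ### Generators at the crossings of a state -/

namespace VirtualKhovanov

namespace Diagram

variable {D : Diagram} {κ : Convention} {s t : D.State} {τ : Fin D.n}

namespace GlobalChoice

variable (k : Type*) [CommRing k] (g : D.GlobalChoice)

theorem opX_eq_of_loop_eq {o : D.HalfEdge → ℤˣ} (ho : IsOrientation t o) {a b : D.HalfEdge}
    (h : loop t a = loop t b) : g.opX k κ t (Sum.inl a) =
      ((align κ o a * align κ o b : ℤˣ) : ℤ) • g.opX k κ t (Sum.inl b) := by
  rw [opX, opX, pt_eq_iff.2 h, smul_smul, ← g.transport_mul ho h]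
  congr 1
  change _ = ((_ : ℤˣ) : ℤ) * (g.transport κ t b : ℤ)
  rw [← Units.val_mul, mul_assoc, Int.units_mul_self, mul_one]
  rfl

/-- Multiplication by the sum of the generators of the two arcs at `τ`. -/
noncomputable def sumX (κ : Convention) (t : D.State) (τ : Fin D.n) :
    D.Chain k t →ₗ[k] D.Chain k t :=
  g.opX k κ t (Sum.inl (τ, .sw)) + g.opX k κ t (Sum.inl (τ, .ne))

theorem sumX_comm (τ τ' : Fin D.n) (x : D.Chain k t) :
    g.sumX k κ t τ (g.sumX k κ t τ' x) = g.sumX k κ t τ' (g.sumX k κ t τ x) := by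
  simp only [sumX, LinearMap.add_apply, map_add]
  rw [g.opX_comm k (Sum.inl (τ, .sw)), g.opX_comm k (Sum.inl (τ, .ne)),
    g.opX_comm k (Sum.inl (τ, .sw)) (Sum.inl (τ', .ne)),
    g.opX_comm k (Sum.inl (τ, .ne)) (Sum.inl (τ', .ne))]
  abel

theorem partialDiff_sumX (hf : Flip τ s t) (τ' : Fin D.n) (x : D.Chain k s) :
    g.partialDiff k κ s t τ (g.sumX k κ s τ' x) =
      g.sumX k κ t τ' (g.partialDiff k κ s t τ x) := by
  simp only [sumX, LinearMap.add_apply, map_add, g.partialDiff_opX k hf]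

theorem partialDiff_unit_of_split_sumX (hf : Flip τ s t) (ht : Dist t τ) :
    g.partialDiff k κ s t τ (unit k s) =
      (g.edgeSign κ s t τ : ℤ) • g.sumX k κ t τ (unit k t) :=
  g.partialDiff_unit_of_split k hf ht

/-- Points of one cycle give the same operator up to their relative alignment, which here is the
same for both pairs of corners. The value of `u` plays no role since the sum is symmetric. -/
theorem sumX_eq_of_match {o : D.HalfEdge → ℤˣ} (ho : IsOrientation t o) {τ₁ τ₂ : Fin D.n} {u : ℤˣ}
    (h₁ : o (τ₁, .sw) = o (τ₁, .ne)) (h₂ : o (τ₂, .sw) = o (τ₂, .ne)) (h : Match t τ₁ τ₂ u) :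
    g.sumX k κ t τ₂ = ((o (τ₁, .sw) * o (τ₂, .sw) : ℤˣ) : ℤ) • g.sumX k κ t τ₁ := by
  have key : ∀ x y, (x = Corner.sw ∨ x = Corner.ne) → (y = Corner.sw ∨ y = Corner.ne) →
      align κ o (τ₂, x) * align κ o (τ₁, y) = o (τ₁, .sw) * o (τ₂, .sw) := by
    intro x y hx hy
    rw [align_corner κ ho h₁ y, align_corner κ ho h₂ x, align, align, mul_mul_mul_comm,
      Int.units_mul_self, one_mul, mul_comm]
  rcases h with ⟨-, a, b⟩ | ⟨-, a, b⟩
  · rw [sumX, sumX, g.opX_eq_of_loop_eq k ho a, g.opX_eq_of_loop_eq k ho b, key, key, smul_add] <;>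
      simp
  · rw [sumX, sumX, g.opX_eq_of_loop_eq k ho a, g.opX_eq_of_loop_eq k ho b, key, key, add_comm,
      smul_add] <;> simp

/-- Where one cycle is turned into one cycle, the two arcs carry opposite generators. -/
theorem sumX_eq_zero (hf : Flip τ s t) (hs : ¬ Dist s τ) (ht : ¬ Dist t τ) :
    g.sumX k κ t τ = 0 := by
  obtain ⟨o, ho⟩ := exists_isOrientation t
  have h : o (τ, .sw) ≠ o (τ, .ne) := fun h => hs ((hf.symm.dist_iff ho).2 ⟨ht, h⟩)
  have h' : o (τ, .sw) = - o (τ, .ne) := by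
    have : ∀ a b : ℤˣ, a ≠ b → a = -b := by decide
    exact this _ _ h
  refine LinearMap.ext fun x => ?_
  rw [sumX, g.opX_eq_of_loop_eq k ho (not_not.1 ht), align, align, h', κ.inSign_ne, mul_neg,
    neg_mul, Int.units_mul_self, Units.val_neg, Units.val_one, LinearMap.add_apply,
    LinearMap.smul_apply, neg_smul, one_smul, neg_add_cancel, LinearMap.zero_apply]

theorem edge_trichotomy (g : D.GlobalChoice) (hf : Flip τ s t) :
    (Dist s τ ∧ ¬ Dist t τ ∧ Fintype.card (D.Cycle s) = Fintype.card (D.Cycle t) + 1) ∨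
    (¬ Dist s τ ∧ Dist t τ ∧ Fintype.card (D.Cycle t) = Fintype.card (D.Cycle s) + 1) ∨
    (¬ Dist s τ ∧ ¬ Dist t τ ∧ Fintype.card (D.Cycle s) = Fintype.card (D.Cycle t)) := by
  by_cases hs : Dist s τ
  · exact Or.inl ⟨hs, hf.not_dist hs, g.card_of_dist hf hs⟩
  · by_cases ht : Dist t τ
    · exact Or.inr (Or.inl ⟨hs, ht, g.card_of_dist hf.symm ht⟩)
    · exact Or.inr (Or.inr ⟨hs, ht, g.card_of_not_dist hf hs ht⟩)

/-! ### Anticommutativity of the faces -/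

section Face

variable {τ₁ τ₂ : Fin D.n} {s₁ s₂ : D.State}

theorem comp_unit_merge_merge (f₁ : Flip τ₁ s s₁) (f₂ : Flip τ₂ s₁ t) (d₁ : Dist s τ₁)
    (d₂ : Dist s₁ τ₂) :
    g.partialDiff k κ s₁ t τ₂ (g.partialDiff k κ s s₁ τ₁ (unit k s)) =
      ((g.edgeSign κ s s₁ τ₁ * g.edgeSign κ s₁ t τ₂ : ℤˣ) : ℤ) • unit k t := by
  rw [g.partialDiff_unit_of_dist k f₁ d₁, map_zsmul, g.partialDiff_unit_of_dist k f₂ d₂, smul_smul,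
    Units.val_mul]

theorem comp_unit_merge_split (f₁ : Flip τ₁ s s₁) (f₂ : Flip τ₂ s₁ t) (d₁ : Dist s τ₁)
    (d₂ : Dist t τ₂) :
    g.partialDiff k κ s₁ t τ₂ (g.partialDiff k κ s s₁ τ₁ (unit k s)) =
      ((g.edgeSign κ s s₁ τ₁ * g.edgeSign κ s₁ t τ₂ : ℤˣ) : ℤ) •
        g.sumX k κ t τ₂ (unit k t) := by
  rw [g.partialDiff_unit_of_dist k f₁ d₁, map_zsmul, g.partialDiff_unit_of_split_sumX k f₂ d₂,
    smul_smul, Units.val_mul]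

theorem comp_unit_split_merge (f₁ : Flip τ₁ s s₁) (f₂ : Flip τ₂ s₁ t) (d₁ : Dist s₁ τ₁)
    (d₂ : Dist s₁ τ₂) :
    g.partialDiff k κ s₁ t τ₂ (g.partialDiff k κ s s₁ τ₁ (unit k s)) =
      ((g.edgeSign κ s s₁ τ₁ * g.edgeSign κ s₁ t τ₂ : ℤˣ) : ℤ) •
        g.sumX k κ t τ₁ (unit k t) := by
  rw [g.partialDiff_unit_of_split_sumX k f₁ d₁, map_zsmul, g.partialDiff_sumX k f₂,
    g.partialDiff_unit_of_dist k f₂ d₂, map_zsmul, smul_smul, Units.val_mul]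

theorem comp_unit_split_split (f₁ : Flip τ₁ s s₁) (f₂ : Flip τ₂ s₁ t) (d₁ : Dist s₁ τ₁)
    (d₂ : Dist t τ₂) :
    g.partialDiff k κ s₁ t τ₂ (g.partialDiff k κ s s₁ τ₁ (unit k s)) =
      ((g.edgeSign κ s s₁ τ₁ * g.edgeSign κ s₁ t τ₂ : ℤˣ) : ℤ) •
        g.sumX k κ t τ₁ (g.sumX k κ t τ₂ (unit k t)) := by
  rw [g.partialDiff_unit_of_split_sumX k f₁ d₁, map_zsmul, g.partialDiff_sumX k f₂,
    g.partialDiff_unit_of_split_sumX k f₂ d₂, map_zsmul, smul_smul, Units.val_mul]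

theorem zsmul_eq_neg {M : Type*} [AddCommGroup M] {a b : ℤˣ} (h : a = -b) (x : M) :
    (a : ℤ) • x = - ((b : ℤ) • x) := by
  rw [h, Units.val_neg, neg_smul]

/-- A merge and a split at independent places anticommute. -/
theorem face_unit_merge_split (hτ : τ₁ ≠ τ₂) (f₁ : Flip τ₁ s s₁) (f₂ : Flip τ₂ s₁ t)
    (f₂' : Flip τ₂ s s₂) (f₁' : Flip τ₁ s₂ t) (a : Dist s τ₁) (b : Dist t τ₂) (c : Dist s₂ τ₂)
    (d : Dist s₂ τ₁) :
    g.partialDiff k κ s₁ t τ₂ (g.partialDiff k κ s s₁ τ₁ (unit k s)) =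
      - g.partialDiff k κ s₂ t τ₁ (g.partialDiff k κ s s₂ τ₂ (unit k s)) := by
  rw [g.comp_unit_merge_split k f₁ f₂ a b, g.comp_unit_split_merge k f₂' f₁' c d]
  refine zsmul_eq_neg ?_ _
  -- Seen from `s₂`, the state with the most cycles, the face is a pair of independent merges ending
  -- in `s₁`. Each arc sign then occurs twice.
  have e := EdgeRel.diamond g f₂'.symm f₁ f₁' f₂.symm c a d b
    (g.edgeRel_of_split κ f₂' c) (g.edgeRel_of_merge κ f₁ a)
    (g.edgeRel_of_merge κ f₁' d) (g.edgeRel_of_split κ f₂ b)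
  rw [arcSign_congr κ (f₂'.2 _ hτ), ← arcSign_congr κ (f₁'.2 _ hτ.symm)] at e
  generalize g.edgeSign κ s s₁ τ₁ = ε₁ at *
  generalize g.edgeSign κ s₁ t τ₂ = ε₂ at *
  generalize g.edgeSign κ s s₂ τ₂ = δ₂ at *
  generalize g.edgeSign κ s₂ t τ₁ = δ₁ at *
  generalize arcSign κ s₂ τ₁ = x at *
  generalize arcSign κ s₂ τ₂ = y at *
  revert e
  revert ε₁ ε₂ δ₁ δ₂ x y
  decide

theorem face_unit_merge_merge (hτ : τ₁ ≠ τ₂) (f₁ : Flip τ₁ s s₁) (f₂ : Flip τ₂ s₁ t)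
    (f₂' : Flip τ₂ s s₂) (f₁' : Flip τ₁ s₂ t) (a : Dist s τ₁) (b : Dist s₁ τ₂) (c : Dist s τ₂)
    (d : Dist s₂ τ₁) :
    g.partialDiff k κ s₁ t τ₂ (g.partialDiff k κ s s₁ τ₁ (unit k s)) =
      - g.partialDiff k κ s₂ t τ₁ (g.partialDiff k κ s s₂ τ₂ (unit k s)) := by
  rw [g.comp_unit_merge_merge k f₁ f₂ a b, g.comp_unit_merge_merge k f₂' f₁' c d]
  refine zsmul_eq_neg ?_ _
  have e := EdgeRel.diamond g f₁ f₂ f₂' f₁' a b c d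
    (g.edgeRel_of_merge κ f₁ a) (g.edgeRel_of_merge κ f₂ b)
    (g.edgeRel_of_merge κ f₂' c) (g.edgeRel_of_merge κ f₁' d)
  rw [arcSign_congr κ (f₂'.2 _ hτ), ← arcSign_congr κ (f₁.2 _ hτ.symm)] at e
  rw [mul_mul_mul_comm, mul_mul_mul_comm (g.edgeSign κ s s₂ τ₂),
    mul_comm (arcSign κ s₂ τ₁), ← neg_mul] at e
  exact mul_right_cancel e

theorem face_unit_split_split (hτ : τ₁ ≠ τ₂) (f₁ : Flip τ₁ s s₁) (f₂ : Flip τ₂ s₁ t)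
    (f₂' : Flip τ₂ s s₂) (f₁' : Flip τ₁ s₂ t) (a : Dist s₁ τ₁) (b : Dist t τ₂) (c : Dist s₂ τ₂)
    (d : Dist t τ₁) :
    g.partialDiff k κ s₁ t τ₂ (g.partialDiff k κ s s₁ τ₁ (unit k s)) =
      - g.partialDiff k κ s₂ t τ₁ (g.partialDiff k κ s s₂ τ₂ (unit k s)) := by
  rw [g.comp_unit_split_split k f₁ f₂ a b, g.comp_unit_split_split k f₂' f₁' c d, g.sumX_comm k]
  refine zsmul_eq_neg ?_ _
  -- Read backwards from `t`, the two splits are two merges.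
  have e := EdgeRel.diamond g f₁'.symm f₂'.symm f₂.symm f₁.symm d c b a
    (g.edgeRel_of_split κ f₁' d) (g.edgeRel_of_split κ f₂' c)
    (g.edgeRel_of_split κ f₂ b) (g.edgeRel_of_split κ f₁ a)
  rw [arcSign_congr κ (f₂.2 _ hτ), ← arcSign_congr κ (f₁'.2 _ hτ.symm)] at e
  rw [mul_mul_mul_comm, mul_mul_mul_comm (g.edgeSign κ s₁ t τ₂),
    mul_comm (arcSign κ t τ₁), ← neg_mul] at e
  rw [mul_comm (g.edgeSign κ s s₁ τ₁), mul_comm (g.edgeSign κ s s₂ τ₂), mul_right_cancel e,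
    neg_neg]

theorem eq_neg_mul_of_bigon {ε₁ ε₂ δ₂ δ₁ a₁ a₂ b₂ b₁ u v x : ℤˣ}
    (h : (ε₁ * a₁) * (ε₂ * a₂) * ((δ₂ * b₂) * (δ₁ * b₁)) = u * v) (hab : a₁ * b₁ = b₂ * a₂)
    (hx : u * v * x = -1) : ε₁ * ε₂ = - (δ₂ * δ₁ * x) := by
  have h' : ε₁ * ε₂ * (δ₂ * δ₁) = u * v := by
    rw [← h]
    calc ε₁ * ε₂ * (δ₂ * δ₁) = ε₁ * ε₂ * (δ₂ * δ₁) * ((a₁ * b₁) * (b₂ * a₂)) := by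
          rw [hab, Int.units_mul_self, mul_one]
      _ = _ := by ac_rfl
  rw [← h'] at hx
  clear h hab h'
  revert ε₁ ε₂ δ₂ δ₁ x
  decide

/-- Two cycles that are merged at either crossing and split again at the other one. -/
theorem face_unit_merge_split_bigon (hτ : τ₁ ≠ τ₂) (f₁ : Flip τ₁ s s₁) (f₂ : Flip τ₂ s₁ t)
    (f₂' : Flip τ₂ s s₂) (f₁' : Flip τ₁ s₂ t) (a : Dist s τ₁) (b : Dist t τ₂) (c : Dist s τ₂)
    (d : Dist t τ₁) :
    g.partialDiff k κ s₁ t τ₂ (g.partialDiff k κ s s₁ τ₁ (unit k s)) =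
      - g.partialDiff k κ s₂ t τ₁ (g.partialDiff k κ s s₂ τ₂ (unit k s)) := by
  obtain ⟨u, hu⟩ := exists_match f₁ c (f₂.symm.not_dist b)
  obtain ⟨v, hv⟩ := exists_match f₁'.symm b (f₂'.not_dist c)
  obtain ⟨o, ho⟩ := exists_isOrientation s₁
  have o₁ := ho.eq_of_dist f₁.symm a
  have o₂ := ho.eq_of_dist f₂ b
  have hx := match_mul_match hτ f₁ f₂ a d b hu hv ho
  have e := EdgeRel.bigon g f₁ f₂ f₂' a c d b hu hv
    (g.edgeRel_of_merge κ f₁ a) (g.edgeRel_of_split κ f₂ b)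
    (g.edgeRel_of_merge κ f₂' c) (g.edgeRel_of_split κ f₁' d)
  have hab : arcSign κ s τ₁ * arcSign κ t τ₁ = arcSign κ s τ₂ * arcSign κ t τ₂ := by
    rw [← arcSign_congr κ (f₂.2 _ hτ), ← arcSign_congr κ (f₁'.2 _ hτ.symm)]
    exact f₁.arcSign_mul f₂'
  rw [g.comp_unit_merge_split k f₁ f₂ a b, g.comp_unit_merge_split k f₂' f₁' c d,
    g.sumX_eq_of_match k (ho.flip f₂ o₂) o₁ o₂ hv, LinearMap.smul_apply, smul_smul,
    ← Units.val_mul]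
  refine zsmul_eq_neg ?_ _
  rw [eq_neg_mul_of_bigon e hab hx, neg_mul, mul_assoc (g.edgeSign κ s s₂ τ₂ * _),
    Int.units_mul_self, mul_one]

/-- A cycle that is split at either crossing and merged again at the other one. -/
theorem face_unit_split_merge_bigon (hτ : τ₁ ≠ τ₂) (f₁ : Flip τ₁ s s₁) (f₂ : Flip τ₂ s₁ t)
    (f₂' : Flip τ₂ s s₂) (f₁' : Flip τ₁ s₂ t) (a : Dist s₁ τ₁) (b : Dist s₁ τ₂) (c : Dist s₂ τ₂)
    (d : Dist s₂ τ₁) :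
    g.partialDiff k κ s₁ t τ₂ (g.partialDiff k κ s s₁ τ₁ (unit k s)) =
      - g.partialDiff k κ s₂ t τ₁ (g.partialDiff k κ s s₂ τ₂ (unit k s)) := by
  obtain ⟨u, hu⟩ := exists_match f₁.symm b (f₂'.symm.not_dist c)
  obtain ⟨v, hv⟩ := exists_match f₁' c (f₂.not_dist b)
  obtain ⟨o, ho⟩ := exists_isOrientation s
  have o₁ := ho.eq_of_dist f₁ a
  have o₂ := ho.eq_of_dist f₂' c
  have hx := match_mul_match hτ f₁.symm f₂' a d c hu hv ho
  -- The bigon is centred at `s₁`: its two cycles merge into `s` or into `t`, and either of these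
  -- splits into the cycles of `s₂`.
  have e := EdgeRel.bigon g f₁.symm f₂' f₂ a b d c hu hv
    (g.edgeRel_of_split κ f₁ a) (g.edgeRel_of_split κ f₂' c)
    (g.edgeRel_of_merge κ f₂ b) (g.edgeRel_of_merge κ f₁' d)
  have hab : arcSign κ s₁ τ₁ * arcSign κ s₂ τ₁ = arcSign κ s₁ τ₂ * arcSign κ s₂ τ₂ := by
    rw [← arcSign_congr κ (f₂'.2 _ hτ), ← arcSign_congr κ (f₁.2 _ hτ.symm)]
    exact f₁.symm.arcSign_mul f₂'
  rw [g.comp_unit_split_merge k f₁ f₂ a b, g.comp_unit_split_merge k f₂' f₁' c d,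
    g.sumX_eq_of_match k ((ho.flip f₁ o₁).flip f₂ o₂) o₁ o₂ (hu.of_flip f₂ (f₂.not_dist b)),
    LinearMap.smul_apply, smul_smul, ← Units.val_mul]
  refine zsmul_eq_neg ?_ _
  have := eq_neg_mul_of_bigon e hab hx
  generalize g.edgeSign κ s s₁ τ₁ = ε₁ at *
  generalize g.edgeSign κ s₁ t τ₂ = ε₂ at *
  generalize g.edgeSign κ s s₂ τ₂ = δ₂ at *
  generalize g.edgeSign κ s₂ t τ₁ = δ₁ at *
  generalize o (τ₁, .sw) * o (τ₂, .sw) = x at *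
  clear hx e hab
  revert ε₁ ε₂ δ₂ δ₁ x
  decide

/-- If one path of a face splits and merges and the other one keeps a single cycle, both vanish. -/
theorem face_unit_split_merge_single (f₁ : Flip τ₁ s s₁) (f₂ : Flip τ₂ s₁ t)
    (f₁' : Flip τ₁ s₂ t) (a : Dist s₁ τ₁) (b : Dist s₁ τ₂) (c : ¬ Dist s₂ τ₁)
    (d : ¬ Dist t τ₁) :
    g.partialDiff k κ s₁ t τ₂ (g.partialDiff k κ s s₁ τ₁ (unit k s)) = 0 := by
  rw [g.comp_unit_split_merge k f₁ f₂ a b, g.sumX_eq_zero k f₁' c d, LinearMap.zero_apply,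
    smul_zero]

/-- Every face of the cube anticommutes at the labelling of all cycles by `1`. -/
theorem face_unit (hτ : τ₁ ≠ τ₂) (f₁ : Flip τ₁ s s₁) (f₂ : Flip τ₂ s₁ t)
    (f₂' : Flip τ₂ s s₂) (f₁' : Flip τ₁ s₂ t) :
    g.partialDiff k κ s₁ t τ₂ (g.partialDiff k κ s s₁ τ₁ (unit k s)) =
      - g.partialDiff k κ s₂ t τ₁ (g.partialDiff k κ s s₂ τ₂ (unit k s)) := by
  have zero₁ : (¬ Dist s τ₁ ∧ ¬ Dist s₁ τ₁) ∨ (¬ Dist s₁ τ₂ ∧ ¬ Dist t τ₂) →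
      g.partialDiff k κ s₁ t τ₂ (g.partialDiff k κ s s₁ τ₁ (unit k s)) = 0 := by
    rintro (h | h)
    · rw [g.partialDiff_eq_zero k h.1 h.2, LinearMap.zero_apply, map_zero]
    · rw [g.partialDiff_eq_zero k h.1 h.2, LinearMap.zero_apply]
  have zero₂ : (¬ Dist s τ₂ ∧ ¬ Dist s₂ τ₂) ∨ (¬ Dist s₂ τ₁ ∧ ¬ Dist t τ₁) →
      g.partialDiff k κ s₂ t τ₁ (g.partialDiff k κ s s₂ τ₂ (unit k s)) = 0 := by
    rintro (h | h)
    · rw [g.partialDiff_eq_zero k h.1 h.2, LinearMap.zero_apply, map_zero]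
    · rw [g.partialDiff_eq_zero k h.1 h.2, LinearMap.zero_apply]
  -- If one cycle of `s` passes through `τ₂`, the change at `τ₂` joins no cycles, so different
  -- cycles stay different.
  have persist₁ : Dist s τ₁ → ¬ Dist s τ₂ → Dist s₂ τ₁ := fun a c h =>
    a (f₂'.symm.loop_eq_of_not_dist c h)
  have persist₂ : Dist s τ₂ → ¬ Dist s τ₁ → Dist s₁ τ₂ := fun c a h =>
    c (f₁.symm.loop_eq_of_not_dist a h)
  have t₁ := g.edge_trichotomy f₁
  have t₂ := g.edge_trichotomy f₂
  have t₂' := g.edge_trichotomy f₂'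
  have t₁' := g.edge_trichotomy f₁'
  generalize Fintype.card (D.Cycle s) = n at t₁ t₂'
  generalize Fintype.card (D.Cycle s₁) = n₁ at t₁ t₂
  generalize Fintype.card (D.Cycle s₂) = n₂ at t₁' t₂'
  generalize Fintype.card (D.Cycle t) = n₁₂ at t₁' t₂
  rcases t₁ with ⟨a, a', ca⟩ | ⟨a, a', ca⟩ | ⟨a, a', ca⟩
  · rcases t₂ with ⟨b, b', cb⟩ | ⟨b, b', cb⟩ | ⟨b, b', cb⟩
    · obtain ⟨c, d⟩ : Dist s τ₂ ∧ Dist s₂ τ₁ := by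
        rcases t₂' with ⟨c, c', cc⟩ | ⟨c, c', cc⟩ | ⟨c, c', cc⟩ <;>
          rcases t₁' with ⟨d, d', cd⟩ | ⟨d, d', cd⟩ | ⟨d, d', cd⟩ <;> first | omega | exact ⟨c, d⟩
      exact g.face_unit_merge_merge k hτ f₁ f₂ f₂' f₁' a b c d
    · rcases t₂' with ⟨c, c', cc⟩ | ⟨c, c', cc⟩ | ⟨c, c', cc⟩
      · obtain ⟨d, d', cd⟩ := (t₁'.resolve_left fun h => by omega).resolve_right fun h => by omega
        exact g.face_unit_merge_split_bigon k hτ f₁ f₂ f₂' f₁' a b' c d'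
      · exact g.face_unit_merge_split k hτ f₁ f₂ f₂' f₁' a b' c' (persist₁ a c)
      -- This case does not occur: the two cycles at `τ₁` persist in `s₂` and would merge there,
      -- against the cycle count.
      · rcases t₁' with ⟨d, d', cd⟩ | ⟨d, d', cd⟩ | ⟨d, d', cd⟩
        · omega
        · exact (d (persist₁ a c)).elim
        · exact (d (persist₁ a c)).elim
    -- The number of cycles changes by one in total, so by parity the other path also contains a
    -- single-cycle edge.
    · rw [zero₁ (Or.inr ⟨b, b'⟩), zero₂, neg_zero]
      rcases t₂' with ⟨c, c', cc⟩ | ⟨c, c', cc⟩ | ⟨c, c', cc⟩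
      · exact Or.inr (by rcases t₁' with h | h | h; exacts [by omega, by omega, ⟨h.1, h.2.1⟩])
      · exact Or.inr (by rcases t₁' with h | h | h; exacts [by omega, by omega, ⟨h.1, h.2.1⟩])
      · exact Or.inl ⟨c, c'⟩
  · rcases t₂ with ⟨b, b', cb⟩ | ⟨b, b', cb⟩ | ⟨b, b', cb⟩
    · rcases t₂' with ⟨c, c', cc⟩ | ⟨c, c', cc⟩ | ⟨c, c', cc⟩
      · obtain ⟨d, d', cd⟩ := (t₁'.resolve_left fun h => by omega).resolve_right fun h => by omega
        exact neg_eq_iff_eq_neg.1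
          (g.face_unit_merge_split k hτ.symm f₂' f₁' f₁ f₂ c d' a' b).symm
      · obtain ⟨d, d', cd⟩ := t₁'.resolve_right fun h => by omega
        exact g.face_unit_split_merge_bigon k hτ f₁ f₂ f₂' f₁' a' b c' d
      · obtain ⟨d, d', cd⟩ := (t₁'.resolve_left fun h => by omega).resolve_left fun h => by omega
        rw [g.face_unit_split_merge_single k f₁ f₂ f₁' a' b d d', zero₂ (Or.inl ⟨c, c'⟩), neg_zero]
    · obtain ⟨c', d'⟩ : Dist s₂ τ₂ ∧ Dist t τ₁ := by
        rcases t₂' with ⟨c, c', cc⟩ | ⟨c, c', cc⟩ | ⟨c, c', cc⟩ <;>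
          rcases t₁' with ⟨d, d', cd⟩ | ⟨d, d', cd⟩ | ⟨d, d', cd⟩ <;> first | omega | exact ⟨c', d'⟩
      exact g.face_unit_split_split k hτ f₁ f₂ f₂' f₁' a' b' c' d'
    · rw [zero₁ (Or.inr ⟨b, b'⟩), zero₂, neg_zero]
      rcases t₂' with ⟨c, c', cc⟩ | ⟨c, c', cc⟩ | ⟨c, c', cc⟩
      · exact Or.inr (by rcases t₁' with h | h | h; exacts [by omega, by omega, ⟨h.1, h.2.1⟩])
      · exact Or.inr (by rcases t₁' with h | h | h; exacts [by omega, by omega, ⟨h.1, h.2.1⟩])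
      · exact Or.inl ⟨c, c'⟩
  · rw [zero₁ (Or.inl ⟨a, a'⟩)]
    rcases t₂' with ⟨c, c', cc⟩ | ⟨c, c', cc⟩ | ⟨c, c', cc⟩
    · rcases t₁' with ⟨d, d', cd⟩ | ⟨d, d', cd⟩ | ⟨d, d', cd⟩
      · omega
      · rcases t₂ with h | h | h
        · omega
        · exact (h.1 (persist₂ c a)).elim
        · exact (h.1 (persist₂ c a)).elim
      · rw [zero₂ (Or.inr ⟨d, d'⟩), neg_zero]
    · rcases t₁' with ⟨d, d', cd⟩ | ⟨d, d', cd⟩ | ⟨d, d', cd⟩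
      · obtain ⟨b, b', cb⟩ := (t₂.resolve_left fun h => by omega).resolve_left fun h => by omega
        rw [g.face_unit_split_merge_single k f₂' f₁' f₂ c' d b b', neg_zero]
      · omega
      · rw [zero₂ (Or.inr ⟨d, d'⟩), neg_zero]
    · rw [zero₂ (Or.inl ⟨c, c'⟩), neg_zero]

/-- Every face of the cube anticommutes. -/
theorem face_anticomm (hτ : τ₁ ≠ τ₂) (f₁ : Flip τ₁ s s₁) (f₂ : Flip τ₂ s₁ t)
    (f₂' : Flip τ₂ s s₂) (f₁' : Flip τ₁ s₂ t) :
    g.partialDiff k κ s₁ t τ₂ ∘ₗ g.partialDiff k κ s s₁ τ₁ =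
      - (g.partialDiff k κ s₂ t τ₁ ∘ₗ g.partialDiff k κ s s₂ τ₂) := by
  refine g.ext_unit k (κ := κ) (fun p x => ?_) (fun p x => ?_) ?_
  · simp only [LinearMap.comp_apply, g.partialDiff_opX k f₁, g.partialDiff_opX k f₂]
  · simp only [LinearMap.neg_apply, LinearMap.comp_apply, g.partialDiff_opX k f₂',
      g.partialDiff_opX k f₁', map_neg]
  · rw [LinearMap.neg_apply, LinearMap.comp_apply, LinearMap.comp_apply]
    exact g.face_unit k hτ f₁ f₂ f₂' f₁'

end Face

/-! ### The square of the differential -/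

theorem flip_update {s : D.State} {τ : Fin D.n} (h : s τ = .A) :
    Flip τ s (Function.update s τ .B) :=
  ⟨by rw [h, Function.update_self]; simp, fun c hc => (Function.update_of_ne hc _ _).symm⟩

theorem face_anticomm_update {s s₁ s₂ t : D.State} {τ₁ τ₂ : Fin D.n} (hτ : τ₁ ≠ τ₂)
    (h₁ : s τ₁ = .A) (h₂ : s τ₂ = .A) (e₁ : s₁ = Function.update s τ₁ .B)
    (e₂ : s₂ = Function.update s τ₂ .B) (e : t = Function.update s₁ τ₂ .B) :
    g.partialDiff k κ s₁ t τ₂ ∘ₗ g.partialDiff k κ s s₁ τ₁ =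
      - (g.partialDiff k κ s₂ t τ₁ ∘ₗ g.partialDiff k κ s s₂ τ₂) := by
  have e' : t = Function.update s₂ τ₁ .B := by rw [e, e₁, e₂, Function.update_comm hτ]
  refine g.face_anticomm k hτ (e₁ ▸ flip_update h₁) (e ▸ flip_update ?_) (e₂ ▸ flip_update h₂)
    (e' ▸ flip_update ?_)
  · rw [e₁, Function.update_of_ne hτ.symm, h₂]
  · rw [e₂, Function.update_of_ne hτ, h₁]

theorem differential_comp_self (κ : Convention) :
    g.differential k κ ∘ₗ g.differential k κ = 0 := by
  refine LinearMap.ext fun x => funext fun t => ?_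
  let F : (_ : Fin D.n) × Fin D.n → D.Chain k t := fun p =>
    g.partialDiff k κ (Function.update t p.1 .A) t p.1
      (g.partialDiff k κ (Function.update (Function.update t p.1 .A) p.2 .A)
        (Function.update t p.1 .A) p.2 (x (Function.update (Function.update t p.1 .A) p.2 .A)))
  have expand : (g.differential k κ ∘ₗ g.differential k κ) x t =
      ∑ p ∈ (Finset.univ.filter fun τ => t τ = .B).sigma fun τ =>
        Finset.univ.filter fun τ' => Function.update t τ Smoothing.A τ' = .B, F p := by
    rw [Finset.sum_sigma]
    simp [differential, F, LinearMap.sum_apply, map_sum]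
  rw [expand]
  -- The two orders of changing a pair of crossings cancel by the anticommuting face.
  refine Finset.sum_involution (fun p _ => ⟨p.2, p.1⟩) ?_ ?_ ?_ ?_
  · rintro ⟨τ, τ'⟩ hp
    simp only [Finset.mem_sigma, Finset.mem_filter, Finset.mem_univ, true_and] at hp
    obtain ⟨h, h'⟩ := hp
    have hne : τ' ≠ τ := by
      rintro rfl; simp at h'
    rw [Function.update_of_ne hne] at h'
    have := g.face_anticomm_update k (κ := κ) (s := Function.update (Function.update t τ .A) τ' .A)
      (s₁ := Function.update t τ .A) (s₂ := Function.update t τ' .A) (t := t) hne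
      (Function.update_self ..) (by rw [Function.update_of_ne hne.symm, Function.update_self])
      (by rw [Function.update_idem, ← h', ← Function.update_of_ne hne .A t, Function.update_eq_self])
      (by
        funext c
        by_cases hc : c = τ
        · rw [hc, Function.update_self, Function.update_of_ne hne.symm, h]
        · rw [Function.update_of_ne hc]
          by_cases hc' : c = τ'
          · rw [hc', Function.update_self, Function.update_self]
          · rw [Function.update_of_ne hc', Function.update_of_ne hc', Function.update_of_ne hc])
      (by rw [Function.update_idem, ← h, Function.update_eq_self])
    have := LinearMap.congr_fun this (x (Function.update (Function.update t τ .A) τ' .A))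
    simp only [LinearMap.comp_apply, LinearMap.neg_apply] at this
    simp only [F]
    rw [this, Function.update_comm hne]
    exact neg_add_cancel _
  · rintro ⟨τ, τ'⟩ hp _ h
    simp only [Finset.mem_sigma, Finset.mem_filter, Finset.mem_univ, true_and] at hp
    obtain rfl : τ' = τ := congrArg Sigma.fst h
    simp at hp
  · rintro ⟨τ, τ'⟩ hp
    simp only [Finset.mem_sigma, Finset.mem_filter, Finset.mem_univ, true_and] at hp ⊢
    obtain ⟨h, h'⟩ := hp
    have hne : τ' ≠ τ := by
      rintro rfl; simp at h'
    rw [Function.update_of_ne hne] at h'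
    exact ⟨h', by rw [Function.update_of_ne hne.symm, h]⟩
  · rintro ⟨τ, τ'⟩ _
    rfl

end GlobalChoice

end Diagram

end VirtualKhovanov

theorem mainTheorem4 (k : Type*) [CommRing k] (κ : VirtualKhovanov.Convention)
    (D : VirtualKhovanov.Diagram) (g : D.GlobalChoice) :
    (∀ (s : D.State) (τ₁ τ₂ : Fin D.n), τ₁ ≠ τ₂ →
      s τ₁ = VirtualKhovanov.Smoothing.A → s τ₂ = VirtualKhovanov.Smoothing.A →
      ∀ s₁ s₂ t : D.State,
        s₁ = Function.update s τ₁ VirtualKhovanov.Smoothing.B →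
        s₂ = Function.update s τ₂ VirtualKhovanov.Smoothing.B →
        t = Function.update s₁ τ₂ VirtualKhovanov.Smoothing.B →
        g.partialDiff k κ s₁ t τ₂ ∘ₗ g.partialDiff k κ s s₁ τ₁ =
          -(g.partialDiff k κ s₂ t τ₁ ∘ₗ g.partialDiff k κ s s₂ τ₂)) ∧
    g.differential k κ ∘ₗ g.differential k κ = 0 :=
  ⟨fun _ _ _ hτ h₁ h₂ _ _ _ e₁ e₂ e => g.face_anticomm_update k hτ h₁ h₂ e₁ e₂ e,
    g.differential_comp_self k κ⟩
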